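/- Let $n\ge 0$ be an integer and $a\in\mathbb{C}$, $a\neq 0$. Let $D_n(x,a)$ and $F_n(x,a)$ be the Dickson polynomials of the first and of the third kind with parameter $a$: for $n\ge 1$, $$D_n(x,a)=\sum_{i=0}^{\lfloor n/2\rfloor}\frac{n}{n-i}\binom{n-i}{i}(-a)^i x^{n-2i},\qquad F_n(x,a)=\sum_{i=0}^{\lfloor n/2\rfloor}\frac{n-2i}{n-i}\binom{n-i}{i}(-a)^i x^{n-2i},$$ and $D_0=2$, $F_0=0$. Consider $$(x^2-4a)F''+3xF'-n^2F=2n\,D_n(x,a)\qquad(1)$$ and the associated homogeneous equation $$(x^2-4a)F''+3xF'-n^2F=0.\qquad(2)$$ (i) Particular solution. Let $b_0,\dots,b_n\in\mathbb{C}$ and put $b_{n+1}=b_{n+2}=0$. The polynomial $F_p(x)=\sum_{k=0}^n b_kx^k$ satisfies (1) if and only if for all $0\le k\le n$ $$b_{k+2}=-\frac{n^2-k(k+2)}{4a(k+2)(k+1)}\,b_k\quad\text{if } n\not\equiv k \pmod 2,$$ $$b_{k+2}=\frac{1}{4a(k+2)(k+1)}\Big\{[k(k+2)-n^2]\,b_k-2n\,d_{k}\Big\}\quad\text{if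 } n\equiv k \pmod 2,$$ where $d_k$ is the coefficient of $x^{k}=x^{n-2i}$, $i=\frac{n-k}{2}$, in $D_n(x,a)$. Such $b_0,\dots,b_n$ exist. (ii) General solution of (2). Put $\nu=\sqrt{n^2+1}-\frac12$ and let $\sqrt a$ be either square root of $a$. Let $V\subseteq\mathbb{C}$ be open and connected, and let $\sqrt[4]{x^2-4a}$ be any continuous branch of the fourth root on $V$. Suppose that one of the following holds: (a) $\frac{x}{2\sqrt a}\notin(-\infty,1]$ for all $x\in V$, and $P_\nu^{1/2}$, $Q_\nu^{1/2}$ are the associated Legendre functions of the first and second kinds on $\mathbb{C}\setminus(-\infty,1]$; (b) $\frac{x}{2\sqrt a}\notin(-\infty,-1]\cup[1,\infty)$ for all $x\in V$, and $P_\nu^{1/2}$, $Q_\nu^{1/2}$ are the associated Legendre functions on the interval $(-1,1)$ (Ferrers functions), continued analytically to $\mathbb{C}\setminus((-\infty,-1]\cup[1,\infty))$. Then a function $F:V\to\mathbb{C}$ is a holomorphic solution of (2) on $V$ if and only if there are constants $A,B\in\mathbb{C}$ with $F=F_c$ on $V$, where $$F_c(x)=\frac{1}{\sqrt[4]{x^2-4a}}\Big[A\,P_\nu^{1/2}\Big(\frac{x}{2\sqrt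 a}\Big)+B\,Q_\nu^{1/2}\Big(\frac{x}{2\sqrt a}\Big)\Big].$$ (iii) General solution of (1). In the situation of (ii), let $F_p$ be as in (i), with coefficients satisfying the recurrences. Then a function $F:V\to\mathbb{C}$ is a holomorphic solution of (1) on $V$ if and only if $F=F_c+F_p$ on $V$ for some constants $A,B\in\mathbb{C}$. In particular, there are constants $A,B\in\mathbb{C}$ with $F_n(x,a)=F_c(x)+F_p(x)$ for all $x\in V$. -/

import Mathlib

/-- The plane cut along `[1, ∞)`, the domain of the principal branch of Gauss's function. -/
def hypergeometricDomain : Set ℂ := {w | 1 - w ∈ Complex.slitPlane}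

/-- `f` is the analytic continuation of Gauss's series `₂F₁(a, b; c; w)`, `|w| < 1`, to the
plane cut along `[1, ∞)`. -/
def IsHypergeometricContinuation (a b c : ℂ) (f : ℂ → ℂ) : Prop :=
  DifferentiableOn ℂ f hypergeometricDomain ∧
    ∀ w ∈ Metric.ball (0 : ℂ) 1, f w = ordinaryHypergeometric a b c w

open Classical in
/-- The principal branch of Gauss's hypergeometric function `F(a, b; c; w)`: the analytic
continuation of the power series to the plane cut along `[1, ∞)`. (Should there be no
continuation, the power series itself is taken; so the values on the unit disk are always those
of the series.) -/
noncomputable def hypergeometricF (a b c : ℂ) : ℂ → ℂ :=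
  if h : ∃ f : ℂ → ℂ, IsHypergeometricContinuation a b c f then h.choose
  else ordinaryHypergeometric a b c

theorem hypergeometricF_eq_series (a b c : ℂ) {w : ℂ} (hw : w ∈ Metric.ball (0 : ℂ) 1) :
    hypergeometricF a b c w = ordinaryHypergeometric a b c w := by
  unfold hypergeometricF
  split_ifs with h
  · exact h.choose_spec.2 w hw
  · rfl

/-- The continuation is unique, so `hypergeometricF` does not depend on a choice. -/
theorem hypergeometricF_eq_of_continuation {a b c : ℂ} {f : ℂ → ℂ}
    (hf : IsHypergeometricContinuation a b c f) {w : ℂ} (hw : w ∈ hypergeometricDomain) :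
    hypergeometricF a b c w = f w := by
  have hopen : IsOpen hypergeometricDomain :=
    Complex.isOpen_slitPlane.preimage (continuous_const.sub continuous_id)
  have hconn : IsPreconnected hypergeometricDomain := by
    have h1 : IsPreconnected Complex.slitPlane :=
      (Complex.starConvex_one_slitPlane.isPathConnected
        Complex.one_mem_slitPlane).isConnected.isPreconnected
    have h2 : hypergeometricDomain = (fun w : ℂ => 1 - w) '' Complex.slitPlane := by
      ext w
      constructor
      · intro h
        exact ⟨1 - w, h, by ring⟩
      · rintro ⟨v, hv, rfl⟩
        simpa [hypergeometricDomain] using hv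
    rw [h2]
    exact h1.image _ (continuous_const.sub continuous_id).continuousOn
  have hex : ∃ f : ℂ → ℂ, IsHypergeometricContinuation a b c f := ⟨f, hf⟩
  have hF : IsHypergeometricContinuation a b c (hypergeometricF a b c) := by
    unfold hypergeometricF
    rw [dif_pos hex]
    exact hex.choose_spec
  have h0 : (0 : ℂ) ∈ hypergeometricDomain := by simp [hypergeometricDomain]
  refine (hF.1.analyticOnNhd hopen).eqOn_of_preconnected_of_eventuallyEq
    (hf.1.analyticOnNhd hopen) hconn h0 ?_ hw
  filter_upwards [Metric.ball_mem_nhds (0 : ℂ) one_pos] with v hv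
  rw [hF.2 v hv, hf.2 v hv]

/-- The plane cut along `(-∞, 1]`, where the associated Legendre functions of a complex
argument are holomorphic. -/
def legendreDomain : Set ℂ := {z | z - 1 ∈ Complex.slitPlane}

/-- The associated Legendre function of the first kind `P_ν^μ(z)` on the plane cut along
`(-∞, 1]`. -/
noncomputable def assocLegendreP (ν μ z : ℂ) : ℂ :=
  1 / Complex.Gamma (1 - μ) * ((z + 1) / (z - 1)) ^ (μ / 2) *
    hypergeometricF (-ν) (ν + 1) (1 - μ) ((1 - z) / 2)

/-- The associated Legendre function of the second kind `Q_ν^μ(z)` on the plane cut along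
`(-∞, 1]`. The factor `(z ^ 2 - 1) ^ (μ / 2)` is the branch that is holomorphic there and positive
for `z > 1` and real `μ`. -/
noncomputable def assocLegendreQ (ν μ z : ℂ) : ℂ :=
  Complex.exp (μ * Real.pi * Complex.I) *
    ((Real.sqrt Real.pi : ℂ) * Complex.Gamma (ν + μ + 1) /
      ((2 : ℂ) ^ (ν + 1) * Complex.Gamma (ν + 3 / 2))) *
    ((z - 1) ^ (μ / 2) * (z + 1) ^ (μ / 2) / z ^ (ν + μ + 1)) *
    hypergeometricF ((ν + μ + 1) / 2) ((ν + μ + 2) / 2) (ν + 3 / 2) (1 / z ^ 2)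

/-- The plane cut along `(-∞, -1]` and `[1, ∞)`; it contains the interval `(-1, 1)`. -/
def ferrersDomain : Set ℂ := {z | 1 - z ∈ Complex.slitPlane ∧ 1 + z ∈ Complex.slitPlane}

/-- The associated Legendre function of the first kind on the interval `(-1, 1)`
(Ferrers function), continued to the plane cut along `(-∞, -1]` and `[1, ∞)`. -/
noncomputable def ferrersP (ν μ z : ℂ) : ℂ :=
  1 / Complex.Gamma (1 - μ) * ((1 + z) / (1 - z)) ^ (μ / 2) *
    hypergeometricF (-ν) (ν + 1) (1 - μ) ((1 - z) / 2)

/-- The associated Legendre function of the second kind on the interval `(-1, 1)`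
(Ferrers function), continued to the plane cut along `(-∞, -1]` and `[1, ∞)`, for `μ` not an
integer. -/
noncomputable def ferrersQ (ν μ z : ℂ) : ℂ :=
  Real.pi / (2 * Complex.sin (μ * Real.pi)) *
    (Complex.cos (μ * Real.pi) * ferrersP ν μ z -
      Complex.Gamma (ν + μ + 1) / Complex.Gamma (ν - μ + 1) * ferrersP ν (-μ) z)

/-- The `n`-th Dickson polynomial of the first kind `D_n(x, a)`. -/
noncomputable def dicksonD (n : ℕ) (a : ℂ) : Polynomial ℂ := Polynomial.dickson 1 a n

/-- The `n`-th Dickson polynomial of the third kind `F_n(x, a)`. -/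
noncomputable def dicksonF (n : ℕ) (a : ℂ) : Polynomial ℂ := Polynomial.dickson 3 a n

/-- `(x² - 4a) F'' + 3x F' - n² F` at the point `x`. -/
noncomputable def dicksonOperator (n : ℕ) (a : ℂ) (F : ℂ → ℂ) (x : ℂ) : ℂ :=
  (x ^ 2 - 4 * a) * deriv (deriv F) x + 3 * x * deriv F x - (n : ℂ) ^ 2 * F x

/-- `F` is a holomorphic solution on `V` of `(x² - 4a) F'' + 3x F' - n² F = 0`. -/
def IsHomogeneousSolution (n : ℕ) (a : ℂ) (V : Set ℂ) (F : ℂ → ℂ) : Prop :=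
  DifferentiableOn ℂ F V ∧ ∀ x ∈ V, dicksonOperator n a F x = 0

/-- `F` is a holomorphic solution on `V` of `(x² - 4a) F'' + 3x F' - n² F = 2n D_n(x, a)`. -/
def IsInhomogeneousSolution (n : ℕ) (a : ℂ) (V : Set ℂ) (F : ℂ → ℂ) : Prop :=
  DifferentiableOn ℂ F V ∧
    ∀ x ∈ V, dicksonOperator n a F x = 2 * (n : ℂ) * (dicksonD n a).eval x

/-- The two-step recurrences for the coefficients `b_0, …, b_n`, for `0 ≤ k ≤ n`
(with the coefficients `b_{n+1}`, `b_{n+2}` in the last two of them). -/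
def DicksonRecurrence (n : ℕ) (a : ℂ) (b : ℕ → ℂ) : Prop :=
  ∀ k ≤ n,
    ((Odd n ∧ Even k ∨ Even n ∧ Odd k) →
      b (k + 2) =
        -(((n : ℂ) ^ 2 - k * (k + 2)) / (4 * a * (k + 2) * (k + 1))) * b k) ∧
    ((Odd n ∧ Odd k ∨ Even n ∧ Even k) →
      b (k + 2) =
        1 / (4 * a * (k + 2) * (k + 1)) *
          (((k : ℂ) * (k + 2) - (n : ℂ) ^ 2) * b k
            - 2 * n * (dicksonD n a).coeff (n - 2 * ((n - k) / 2))))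

/-- `F_p(x) = ∑_{k=0}^{n} b_k x^k`. -/
noncomputable def particularSolution (n : ℕ) (b : ℕ → ℂ) (x : ℂ) : ℂ :=
  ∑ k ∈ Finset.range (n + 1), b k * x ^ k

/-- The degree `ν = √(n² + 1) - 1/2`. -/
noncomputable def legendreDegree (n : ℕ) : ℂ := (Real.sqrt ((n : ℝ) ^ 2 + 1) : ℂ) - 1 / 2

/-- `F_c(x) = (x² - 4a)^{-1/4} [A P(x / (2√a)) + B Q(x / (2√a))]`, where `g` is the chosen branch
of the fourth root of `x² - 4a` and `r` the chosen square root of `a`. -/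
noncomputable def complementarySolution (P Q g : ℂ → ℂ) (r A B x : ℂ) : ℂ :=
  1 / g x * (A * P (x / (2 * r)) + B * Q (x / (2 * r)))

/-! Legendre functions of order 1/2 are elementary, and this carries the general solution. Put s =
√(n² + 1) = ν + 1/2 and x = 2√a·z. The substitution F = (x² - 4a)^{-1/2} p(z) turns the homogeneous
equation into Chebyshev's equation (z² - 1)p'' + zp' = s²p, solved by cos(s arccos z), sin(s arccos
z) and (z + √(z² - 1))^{-s}. Up to a branch of a multiple of (z² - 1)^{-1/4}, the first is both
versions of P, the second is the Ferrers Q, and the third is Q on the plane cut along (-∞, 1]. The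
remaining factor (x² - 4a)^{-1/4} is the prefactor 1/g.

To reach these forms from the definitions, each hypergeometric function is matched with a closed
form on the whole cut plane: a holomorphic solution of Gauss's equation with value 1 at the origin
is Gauss's series, and continuation is unique (`hypergeometricF_eq_of_hasDerivAt`). The central
function is cos(2s arcsin √w), with w = (1 - z)/2; its equation and the identity cos² + sin² = 1
(`cosArcsinSqrt_ode`, `cosArcsinSqrt_first_integral`) give both the closed forms and the
nonvanishing Wronskians. Branches of fourth roots never have to be compared: a continuous function
with prescribed nonzero holomorphic fourth power is holomorphic with a known logarithmic derivative.
Constancy of Wronskian quotients then shows that the two functions span all solutions on the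
connected set V.

The recurrences are comparison of coefficients, split by the parity of D_n. Existence comes from F_n
itself, which solves the inhomogeneous equation because n F_n = x D_n' and D_n satisfies (x² -
4a)D'' + xD' = n²D. -/

/-! ### Gauss's series characterised by its differential equation -/

theorem HasSum.of_forall_eq {f g : ℕ → ℂ} {z : ℂ} (h : HasSum f z) (hfg : ∀ k, g k = f k) :
    HasSum g z := by
  rwa [funext hfg]

/-- Power series coefficients are determined by the sum near the origin. -/
theorem eq_zero_of_hasSum_pow_zero {u : ℕ → ℂ}
    (h : ∀ w ∈ Metric.ball (0 : ℂ) 1, HasSum (fun k => u k * w ^ k) 0) (k : ℕ) : u k = 0 := by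
  have hp : HasFPowerSeriesAt (fun _ : ℂ => (0 : ℂ)) (FormalMultilinearSeries.ofScalars ℂ u) 0 := by
    rw [hasFPowerSeriesAt_iff]
    filter_upwards [Metric.ball_mem_nhds (0 : ℂ) one_pos] with z hz
    simpa [mul_comm, FormalMultilinearSeries.coeff_ofScalars] using h z hz
  have h0 := hp.eq_zero
  have := congrArg (fun p => FormalMultilinearSeries.coeff p k) h0
  rw [FormalMultilinearSeries.coeff_ofScalars] at this
  simpa [FormalMultilinearSeries.coeff] using this

/-- If `∑ u_k w^k = g`, then the shifted series `∑ u_{k-1} w^k` sums to `w * g`. -/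
theorem HasSum.mul_self_of_shift {u v : ℕ → ℂ} {w g : ℂ} (h : HasSum (fun k => u k * w ^ k) g)
    (h0 : v 0 = 0) (hv : ∀ k, v (k + 1) = u k) : HasSum (fun k => v k * w ^ k) (w * g) := by
  have h1 : HasSum (fun k => v (k + 1) * w ^ (k + 1)) (w * g) := by
    refine HasSum.of_forall_eq (h.mul_left w) fun k => ?_
    rw [hv, pow_succ]; ring
  have := (hasSum_nat_add_iff (f := fun k => v k * w ^ k) 1).1 h1
  simpa [h0] using this

/-- A solution of the hypergeometric equation that is holomorphic on the unit disk, with value `1`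
at the origin, is Gauss's series. -/
theorem eq_ordinaryHypergeometric_of_ode {a b c : ℂ} (hc : ∀ k : ℕ, c + k ≠ 0) {f : ℂ → ℂ}
    (hf : DifferentiableOn ℂ f (Metric.ball 0 1)) (hf0 : f 0 = 1)
    (hode : ∀ w ∈ Metric.ball (0 : ℂ) 1, w * (1 - w) * deriv (deriv f) w +
      (c - (a + b + 1) * w) * deriv f w - a * b * f w = 0)
    {w : ℂ} (hw : w ∈ Metric.ball (0 : ℂ) 1) : f w = ordinaryHypergeometric a b c w := by
  set u : ℕ → ℂ := fun k => (k.factorial : ℂ)⁻¹ * iteratedDeriv k f 0 with hu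
  have hfac : ∀ k : ℕ, (k.factorial : ℂ) ≠ 0 := fun k => by exact_mod_cast k.factorial_ne_zero
  have hk1 : ∀ k : ℕ, (k : ℂ) + 1 ≠ 0 := fun k => by exact_mod_cast k.succ_ne_zero
  have hf1 := hf.deriv Metric.isOpen_ball
  have hf2 := hf1.deriv Metric.isOpen_ball
  have s0 : ∀ w ∈ Metric.ball (0 : ℂ) 1, HasSum (fun k => u k * w ^ k) (f w) := by
    intro w hw
    refine HasSum.of_forall_eq (Complex.hasSum_taylorSeries_on_ball hf hw) fun k => ?_
    simp only [hu, sub_zero, smul_eq_mul]; ring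
  have s1 : ∀ w ∈ Metric.ball (0 : ℂ) 1,
      HasSum (fun k : ℕ => ((k + 1) * u (k + 1)) * w ^ k) (deriv f w) := by
    intro w hw
    refine HasSum.of_forall_eq (Complex.hasSum_taylorSeries_on_ball hf1 hw) fun k => ?_
    simp only [hu, sub_zero, smul_eq_mul, iteratedDeriv_succ', Nat.factorial_succ]
    push_cast
    have := hfac k
    have := hk1 k
    field_simp
  have s2 : ∀ w ∈ Metric.ball (0 : ℂ) 1,
      HasSum (fun k : ℕ => ((k + 1) * (k + 2) * u (k + 2)) * w ^ k) (deriv (deriv f) w) := by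
    intro w hw
    refine HasSum.of_forall_eq (Complex.hasSum_taylorSeries_on_ball hf2 hw) fun k => ?_
    simp only [hu, sub_zero, smul_eq_mul, iteratedDeriv_succ', Nat.factorial_succ]
    push_cast
    have := hfac k
    have := hk1 k
    have h2 : (k : ℂ) + 1 + 1 ≠ 0 := by exact_mod_cast (k + 1).succ_ne_zero
    field_simp
    ring
  -- Multiplying a series by w shifts its coefficients; each shifted sequence below carries a factor
  -- k, so it vanishes at k = 0 as the shift requires.
  have hrec : ∀ k : ℕ, (k + 1) * (c + k) * u (k + 1) = (a + k) * (b + k) * u k := by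
    intro k
    have key := eq_zero_of_hasSum_pow_zero (u := fun k : ℕ =>
      (k * (k + 1) * u (k + 1)) - (k * (k - 1) * u k) + c * ((k + 1) * u (k + 1))
        - (a + b + 1) * (k * u k) - a * b * u k) (fun w hw => by
      have t1 := (s2 w hw).mul_self_of_shift (v := fun k : ℕ => k * (k + 1) * u (k + 1))
        (by simp) (fun k => by push_cast; ring_nf)
      have t2 := t1.mul_self_of_shift (v := fun k : ℕ => k * (k - 1) * u k)
        (by simp) (fun k => by push_cast; ring_nf)
      have t3 := (s1 w hw).mul_self_of_shift (v := fun k : ℕ => k * u k)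
        (by simp) (fun k => by push_cast; ring_nf)
      have := (((t1.sub t2).add ((s1 w hw).mul_left c)).sub (t3.mul_left (a + b + 1))).sub
        ((s0 w hw).mul_left (a * b))
      rw [show w * deriv (deriv f) w - w * (w * deriv (deriv f) w) + c * deriv f w
        - (a + b + 1) * (w * deriv f w) - a * b * f w = 0 by rw [← hode w hw]; ring] at this
      exact this.of_forall_eq fun k => by ring) k
    linear_combination key
  have hcoef : ∀ k : ℕ, u k = ordinaryHypergeometricCoefficient a b c k := by
    intro k
    induction k with
    | zero => simp [hu, hf0, ordinaryHypergeometricCoefficient]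
    | succ k ih =>
      have h1 := hk1 k
      -- Since c + k ≠ 0, the recurrence determines every coefficient from u 0 = 1.
      have h2 := hc k
      have h3 := hrec k
      rw [ih] at h3
      simp only [ordinaryHypergeometricCoefficient, ascPochhammer_succ_eval, Nat.factorial_succ,
        Nat.cast_mul, mul_inv] at h3 ⊢
      push_cast
      apply mul_left_cancel₀ (mul_ne_zero h1 h2)
      rw [h3]
      field_simp
  rw [ordinaryHypergeometric_eq_tsum]
  refine ((s0 w hw).tsum_eq.symm).trans (tsum_congr fun k => ?_)
  rw [hcoef k, smul_eq_mul]

theorem ball_subset_hypergeometricDomain : Metric.ball (0 : ℂ) 1 ⊆ hypergeometricDomain := by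
  intro w hw
  left
  have h1 : ‖w‖ < 1 := by simpa using hw
  have := (Complex.re_le_norm w).trans_lt h1
  simpa using this

theorem isOpen_hypergeometricDomain : IsOpen hypergeometricDomain :=
  Complex.isOpen_slitPlane.preimage (continuous_const.sub continuous_id)

theorem zero_mem_hypergeometricDomain : (0 : ℂ) ∈ hypergeometricDomain := by
  simp [hypergeometricDomain]

/-- Identification of the principal branch of Gauss's function by its differential equation. -/
theorem hypergeometricF_eq_of_hasDerivAt {a b c : ℂ} (hc : ∀ k : ℕ, c + k ≠ 0) {f f' f'' : ℂ → ℂ}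
    (hf : ∀ w ∈ hypergeometricDomain, HasDerivAt f (f' w) w)
    (hf' : ∀ w ∈ hypergeometricDomain, HasDerivAt f' (f'' w) w) (hf0 : f 0 = 1)
    (hode : ∀ w ∈ hypergeometricDomain, w * (1 - w) * f'' w +
      (c - (a + b + 1) * w) * f' w - a * b * f w = 0)
    {w : ℂ} (hw : w ∈ hypergeometricDomain) : hypergeometricF a b c w = f w := by
  have hd : DifferentiableOn ℂ f hypergeometricDomain :=
    fun w hw => (hf w hw).differentiableAt.differentiableWithinAt
  refine hypergeometricF_eq_of_continuation ⟨hd, fun w hw => ?_⟩ hw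
  refine eq_ordinaryHypergeometric_of_ode hc (hd.mono ball_subset_hypergeometricDomain) hf0
    (fun w hw => ?_) hw
  have hw' := ball_subset_hypergeometricDomain hw
  have h1 : deriv f =ᶠ[nhds w] f' := by
    filter_upwards [isOpen_hypergeometricDomain.mem_nhds hw'] with v hv using (hf v hv).deriv
  rw [h1.deriv_eq, (hf' w hw').deriv, (hf w hw').deriv]
  exact hode w hw'

/-! ### The principal square root and the function cos(2s arcsin √w) -/

theorem Complex.cpow_half_sq (u : ℂ) : (u ^ (1 / 2 : ℂ)) ^ 2 = u := by
  rw [← Complex.cpow_mul_nat]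
  simp

theorem Complex.re_cpow_half_pos {u : ℂ} (hu : u ∈ Complex.slitPlane) :
    0 < (u ^ (1 / 2 : ℂ)).re := by
  rw [Complex.cpow_def_of_ne_zero (Complex.slitPlane_ne_zero hu), Complex.exp_re]
  refine mul_pos (Real.exp_pos _) (Real.cos_pos_of_mem_Ioo ?_)
  have h1 := Complex.neg_pi_lt_arg u
  have h2 := lt_of_le_of_ne (Complex.arg_le_pi u) (Complex.mem_slitPlane_iff_arg.1 hu).1
  have : (Complex.log u * (1 / 2)).im = u.arg / 2 := by
    simp [Complex.mul_im, Complex.log_im]; ring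
  rw [this]
  constructor <;> linarith

theorem Complex.cpow_half_ne_zero {u : ℂ} (hu : u ∈ Complex.slitPlane) : u ^ (1 / 2 : ℂ) ≠ 0 := by
  intro h
  have := Complex.re_cpow_half_pos hu
  rw [h, Complex.zero_re] at this
  exact this.false

theorem HasDerivAt.cpow_half {f : ℂ → ℂ} {f' x : ℂ} (hf : HasDerivAt f f' x)
    (hx : f x ∈ Complex.slitPlane) :
    HasDerivAt (fun y => f y ^ (1 / 2 : ℂ)) (f' / (2 * f x ^ (1 / 2 : ℂ))) x := by
  have h0 := Complex.cpow_half_ne_zero hx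
  have hx0 := Complex.slitPlane_ne_zero hx
  convert hf.cpow_const hx using 1
  rw [Complex.cpow_sub _ _ hx0, Complex.cpow_one]
  field_simp
  rw [Complex.cpow_half_sq]

/-- On the cut x would be a nonpositive real, and its inverse y would then have negative real part
as well. -/
theorem Complex.mem_slitPlane_of_mul_eq_one {x y : ℂ} (h : x * y = 1) (hre : 0 < (x + y).re) :
    x ∈ Complex.slitPlane := by
  by_contra hx
  rw [Complex.mem_slitPlane_iff] at hx
  push Not at hx
  obtain ⟨h1, h2⟩ := hx
  have e1 := congrArg Complex.re h
  have e2 := congrArg Complex.im h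
  simp only [Complex.mul_re, Complex.mul_im, h2, Complex.one_re, Complex.one_im, Complex.add_re]
    at e1 e2 hre
  nlinarith

/-- `cos (2s arcsin v)`, for `v` with `1 - v²` off the negative real axis. -/
noncomputable def cosArcsin (s v : ℂ) : ℂ :=
  (((1 - v ^ 2) ^ (1 / 2 : ℂ) + Complex.I * v) ^ (2 * s) +
    ((1 - v ^ 2) ^ (1 / 2 : ℂ) - Complex.I * v) ^ (2 * s)) / 2

/-- `i sin (2s arcsin v)`, for `v` with `1 - v²` off the negative real axis. -/
noncomputable def sinArcsin (s v : ℂ) : ℂ :=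
  (((1 - v ^ 2) ^ (1 / 2 : ℂ) + Complex.I * v) ^ (2 * s) -
    ((1 - v ^ 2) ^ (1 / 2 : ℂ) - Complex.I * v) ^ (2 * s)) / 2

theorem cosArcsin_neg (s v : ℂ) : cosArcsin s (-v) = cosArcsin s v := by
  unfold cosArcsin
  ring_nf

theorem arcsin_mul_eq_one (v : ℂ) : ((1 - v ^ 2) ^ (1 / 2 : ℂ) + Complex.I * v) *
    ((1 - v ^ 2) ^ (1 / 2 : ℂ) - Complex.I * v) = 1 := by
  have := Complex.cpow_half_sq (1 - v ^ 2)
  linear_combination this - v ^ 2 * Complex.I_sq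

/-- The numbers √(1 - v²) ± iv play the role of exp(±i arcsin v): they are reciprocal and their sum
2√(1 - v²) has positive real part. Hence their principal powers are holomorphic in v. -/
theorem arcsin_add_mem_slitPlane {v : ℂ} (hv : 1 - v ^ 2 ∈ Complex.slitPlane) :
    (1 - v ^ 2) ^ (1 / 2 : ℂ) + Complex.I * v ∈ Complex.slitPlane := by
  refine Complex.mem_slitPlane_of_mul_eq_one (arcsin_mul_eq_one v) ?_
  have hre := Complex.re_cpow_half_pos hv
  rw [add_add_sub_cancel, Complex.add_re]
  linarith

theorem hasDerivAt_sqrt_one_sub_sq {v : ℂ} (hv : 1 - v ^ 2 ∈ Complex.slitPlane) :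
    HasDerivAt (fun v : ℂ => (1 - v ^ 2) ^ (1 / 2 : ℂ)) (-v / (1 - v ^ 2) ^ (1 / 2 : ℂ)) v := by
  have h1 : HasDerivAt (fun v : ℂ => 1 - v ^ 2) (-(2 * v)) v := by
    simpa using (hasDerivAt_pow 2 v).const_sub 1
  convert h1.cpow_half hv using 1
  have := Complex.cpow_half_ne_zero hv
  field_simp

theorem hasDerivAt_arcsin_add_cpow (s : ℂ) {v : ℂ} (hv : 1 - v ^ 2 ∈ Complex.slitPlane) :
    HasDerivAt (fun v : ℂ => ((1 - v ^ 2) ^ (1 / 2 : ℂ) + Complex.I * v) ^ (2 * s))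
      (2 * s * Complex.I / (1 - v ^ 2) ^ (1 / 2 : ℂ) *
        ((1 - v ^ 2) ^ (1 / 2 : ℂ) + Complex.I * v) ^ (2 * s)) v := by
  have hm := arcsin_add_mem_slitPlane hv
  have hq := Complex.cpow_half_ne_zero hv
  have h0 := Complex.slitPlane_ne_zero hm
  refine (((hasDerivAt_sqrt_one_sub_sq hv).fun_add
    ((hasDerivAt_id' v).const_mul Complex.I)).cpow_const (c := 2 * s) hm).congr_deriv ?_
  rw [Complex.cpow_sub _ _ h0, Complex.cpow_one]
  generalize ((1 - v ^ 2) ^ (1 / 2 : ℂ) + Complex.I * v) ^ (2 * s) = t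
  generalize (1 - v ^ 2) ^ (1 / 2 : ℂ) = q at *
  field_simp
  linear_combination -s * t * v * Complex.I_sq

theorem hasDerivAt_arcsin_sub_cpow (s : ℂ) {v : ℂ} (hv : 1 - v ^ 2 ∈ Complex.slitPlane) :
    HasDerivAt (fun v : ℂ => ((1 - v ^ 2) ^ (1 / 2 : ℂ) - Complex.I * v) ^ (2 * s))
      (-(2 * s * Complex.I / (1 - v ^ 2) ^ (1 / 2 : ℂ) *
        ((1 - v ^ 2) ^ (1 / 2 : ℂ) - Complex.I * v) ^ (2 * s))) v := by
  have h := (hasDerivAt_arcsin_add_cpow s (v := -v) (by simpa using hv)).scomp v (hasDerivAt_neg v)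
  simpa [Function.comp_def, ← sub_eq_add_neg] using h

theorem hasDerivAt_cosArcsin (s : ℂ) {v : ℂ} (hv : 1 - v ^ 2 ∈ Complex.slitPlane) :
    HasDerivAt (cosArcsin s)
      (2 * s * Complex.I / (1 - v ^ 2) ^ (1 / 2 : ℂ) * sinArcsin s v) v := by
  refine (((hasDerivAt_arcsin_add_cpow s hv).add
    (hasDerivAt_arcsin_sub_cpow s hv)).div_const 2).congr_deriv ?_
  unfold sinArcsin
  ring

theorem hasDerivAt_sinArcsin (s : ℂ) {v : ℂ} (hv : 1 - v ^ 2 ∈ Complex.slitPlane) :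
    HasDerivAt (sinArcsin s)
      (2 * s * Complex.I / (1 - v ^ 2) ^ (1 / 2 : ℂ) * cosArcsin s v) v := by
  refine (((hasDerivAt_arcsin_add_cpow s hv).sub
    (hasDerivAt_arcsin_sub_cpow s hv)).div_const 2).congr_deriv ?_
  unfold cosArcsin
  ring

theorem cosArcsin_sq_sub_sinArcsin_sq (s : ℂ) {v : ℂ} (hv : 1 - v ^ 2 ∈ Complex.slitPlane) :
    cosArcsin s v ^ 2 - sinArcsin s v ^ 2 = 1 := by
  have hm := arcsin_add_mem_slitPlane hv
  have h1 : (1 - v ^ 2) ^ (1 / 2 : ℂ) - Complex.I * v =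
      ((1 - v ^ 2) ^ (1 / 2 : ℂ) + Complex.I * v)⁻¹ :=
    eq_inv_of_mul_eq_one_right (arcsin_mul_eq_one v)
  have h2 : ((1 - v ^ 2) ^ (1 / 2 : ℂ) + Complex.I * v) ^ (2 * s) ≠ 0 := by
    rw [Ne, Complex.cpow_eq_zero_iff]
    exact fun h => Complex.slitPlane_ne_zero hm h.1
  unfold cosArcsin sinArcsin
  rw [h1, Complex.inv_cpow _ _ (Complex.mem_slitPlane_iff_arg.1 hm).1]
  generalize ((1 - v ^ 2) ^ (1 / 2 : ℂ) + Complex.I * v) ^ (2 * s) = t at *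
  field_simp
  ring

/-- `cos (2s arcsin √w)`, the hypergeometric function `F(-s, s; 1/2; w)`. -/
noncomputable def cosArcsinSqrt (s w : ℂ) : ℂ := cosArcsin s (w ^ (1 / 2 : ℂ))

/-- Evenness of `cosArcsin` makes the choice of square root immaterial. -/
theorem cosArcsinSqrt_sq (s v : ℂ) : cosArcsinSqrt s (v ^ 2) = cosArcsin s v := by
  have h := Complex.cpow_half_sq (v ^ 2)
  unfold cosArcsinSqrt
  rcases sq_eq_sq_iff_eq_or_eq_neg.1 h with h | h <;> rw [h]
  exact cosArcsin_neg s v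

theorem cosArcsinSqrt_zero (s : ℂ) : cosArcsinSqrt s 0 = 1 := by
  have := cosArcsinSqrt_sq s 0
  rw [zero_pow two_ne_zero] at this
  rw [this]
  simp [cosArcsin]

/-- Away from the origin some holomorphic branch of √w is available, and any branch gives the same
value; the origin is a removable singularity. -/
theorem differentiableOn_cosArcsinSqrt (s : ℂ) :
    DifferentiableOn ℂ (cosArcsinSqrt s) hypergeometricDomain := by
  have hnhds : hypergeometricDomain ∈ nhds (0 : ℂ) :=
    isOpen_hypergeometricDomain.mem_nhds zero_mem_hypergeometricDomain
  refine (Complex.differentiableOn_compl_singleton_and_continuousAt_iff hnhds).1 ⟨?_, ?_⟩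
  · rintro w ⟨hw, hw0 : w ≠ 0⟩
    apply DifferentiableAt.differentiableWithinAt
    have hv : ∀ v : ℂ, v ^ 2 = w → DifferentiableAt ℂ (cosArcsin s) v := fun v hv =>
      (hasDerivAt_cosArcsin s (by rw [hv]; exact hw)).differentiableAt
    by_cases h : w ∈ Complex.slitPlane
    · exact DifferentiableAt.comp w (hv _ (Complex.cpow_half_sq w))
        ((hasDerivAt_id w).cpow_half h).differentiableAt
    -- On the negative axis, where the principal root jumps, the branch i√(-w) is used instead.
    · have hneg : -w ∈ Complex.slitPlane := by
        rw [Complex.mem_slitPlane_iff] at h ⊢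
        push Not at h
        left
        rw [Complex.neg_re]
        refine neg_pos.2 (lt_of_le_of_ne h.1 fun h0 => hw0 (Complex.ext h0 h.2))
      have e : cosArcsinSqrt s = fun w => cosArcsin s (Complex.I * (-w) ^ (1 / 2 : ℂ)) := by
        funext w
        rw [← cosArcsinSqrt_sq, mul_pow, Complex.cpow_half_sq, Complex.I_sq]
        ring_nf
      rw [e]
      refine DifferentiableAt.comp w (g := cosArcsin s) (hv _ ?_)
        (((hasDerivAt_neg w).cpow_half hneg).differentiableAt.const_mul _)
      rw [mul_pow, Complex.cpow_half_sq, Complex.I_sq]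
      ring
  · refine ContinuousAt.comp (g := cosArcsin s) ?_ ?_
    · exact (hasDerivAt_cosArcsin s (by simp)).continuousAt
    · exact Complex.continuousAt_cpow_const_of_re_pos (by simp) (by norm_num)

/-- Chain rule for w = v², kept free of division by v so that it can be differentiated again at v =
0. -/
theorem deriv_cosArcsinSqrt_sq (s : ℂ) {v : ℂ} (hv : v ^ 2 ∈ hypergeometricDomain) :
    2 * s * Complex.I / (1 - v ^ 2) ^ (1 / 2 : ℂ) * sinArcsin s v =
      2 * v * deriv (cosArcsinSqrt s) (v ^ 2) := by
  have h1 := hasDerivAt_cosArcsin s hv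
  have h2 := ((differentiableOn_cosArcsinSqrt s).differentiableAt
    (isOpen_hypergeometricDomain.mem_nhds hv)).hasDerivAt.comp v (hasDerivAt_pow 2 v)
  have e : cosArcsinSqrt s ∘ (fun v => v ^ 2) = cosArcsin s := funext fun v => cosArcsinSqrt_sq s v
  rw [e] at h2
  rw [h1.unique h2]
  simp
  ring

theorem differentiableOn_deriv_cosArcsinSqrt (s : ℂ) :
    DifferentiableOn ℂ (deriv (cosArcsinSqrt s)) hypergeometricDomain :=
  (differentiableOn_cosArcsinSqrt s).deriv isOpen_hypergeometricDomain

/-- This is the equation of the harmonic oscillator in θ = arcsin v. It results from computing the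
derivative of the identity `deriv_cosArcsinSqrt_sq` in two ways. -/
theorem cosArcsinSqrt_ode (s : ℂ) {w : ℂ} (hw : w ∈ hypergeometricDomain) :
    w * (1 - w) * deriv (deriv (cosArcsinSqrt s)) w +
      (1 / 2 - w) * deriv (cosArcsinSqrt s) w + s ^ 2 * cosArcsinSqrt s w = 0 := by
  obtain ⟨v, rfl⟩ : ∃ v : ℂ, v ^ 2 = w := ⟨_, Complex.cpow_half_sq w⟩
  have hv : 1 - v ^ 2 ∈ Complex.slitPlane := hw
  have hq := Complex.cpow_half_ne_zero hv
  have h1 := (((hasDerivAt_const v (2 * s * Complex.I)).fun_div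
    (hasDerivAt_sqrt_one_sub_sq hv) hq).fun_mul (hasDerivAt_sinArcsin s hv))
  have h2 := ((hasDerivAt_id' v).const_mul 2).fun_mul
    (((differentiableOn_deriv_cosArcsinSqrt s).differentiableAt
    (isOpen_hypergeometricDomain.mem_nhds hw)).hasDerivAt.comp v (hasDerivAt_pow 2 v))
  have hev : (fun v : ℂ => 2 * s * Complex.I / (1 - v ^ 2) ^ (1 / 2 : ℂ) * sinArcsin s v) =ᶠ[nhds v]
      fun v => 2 * v * deriv (cosArcsinSqrt s) (v ^ 2) := by
    have : (fun v : ℂ => v ^ 2) ⁻¹' hypergeometricDomain ∈ nhds v :=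
      (continuous_pow 2).continuousAt.preimage_mem_nhds (isOpen_hypergeometricDomain.mem_nhds hw)
    filter_upwards [this] with u hu using deriv_cosArcsinSqrt_sq s hu
  have h3 := (h1.congr_of_eventuallyEq hev.symm).unique h2
  have h4 := deriv_cosArcsinSqrt_sq s hw
  have hqq := Complex.cpow_half_sq (1 - v ^ 2)
  rw [cosArcsinSqrt_sq]
  simp only [Function.comp, Nat.cast_ofNat] at h3
  generalize (1 - v ^ 2) ^ (1 / 2 : ℂ) = q at *
  rw [div_mul_eq_mul_div, div_eq_iff hq] at h4
  clear h1 h2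
  field_simp at h3
  apply mul_left_cancel₀ (mul_ne_zero (by norm_num : (4 : ℂ) ≠ 0) hq)
  linear_combination -h3 + v * h4 +
    4 * s ^ 2 * q * cosArcsin s v * Complex.I_sq - q * (2 * deriv (cosArcsinSqrt s) (v ^ 2) +
      4 * v ^ 2 * deriv (deriv (cosArcsinSqrt s)) (v ^ 2)) * hqq

/-- The identity cos² + sin² = 1, with the sine expressed by the derivative in w. It is what keeps
the Wronskians away from zero. -/
theorem cosArcsinSqrt_first_integral (s : ℂ) {w : ℂ} (hw : w ∈ hypergeometricDomain) :
    s ^ 2 * cosArcsinSqrt s w ^ 2 + w * (1 - w) * deriv (cosArcsinSqrt s) w ^ 2 = s ^ 2 := by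
  obtain ⟨v, rfl⟩ : ∃ v : ℂ, v ^ 2 = w := ⟨_, Complex.cpow_half_sq w⟩
  have hv : 1 - v ^ 2 ∈ Complex.slitPlane := hw
  have hq := Complex.cpow_half_ne_zero hv
  have h4 := deriv_cosArcsinSqrt_sq s hw
  have h5 := cosArcsin_sq_sub_sinArcsin_sq s hv
  have hqq := Complex.cpow_half_sq (1 - v ^ 2)
  rw [cosArcsinSqrt_sq]
  generalize (1 - v ^ 2) ^ (1 / 2 : ℂ) = q at *
  rw [div_mul_eq_mul_div, div_eq_iff hq] at h4
  generalize deriv (cosArcsinSqrt s) (v ^ 2) = c at *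
  have h6 : s * Complex.I * sinArcsin s v = v * q * c := by linear_combination h4 / 2
  have h7 : -(s ^ 2 * sinArcsin s v ^ 2) = v ^ 2 * q ^ 2 * c ^ 2 := by
    linear_combination (s * Complex.I * sinArcsin s v + v * q * c) * h6
      - s ^ 2 * sinArcsin s v ^ 2 * Complex.I_sq
  rw [← hqq]
  linear_combination -h7 + s ^ 2 * h5

theorem hasDerivAt_sqrt_one_sub {w : ℂ} (hw : w ∈ hypergeometricDomain) :
    HasDerivAt (fun w : ℂ => (1 - w) ^ (1 / 2 : ℂ)) (-1 / (2 * (1 - w) ^ (1 / 2 : ℂ))) w :=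
  ((hasDerivAt_id' w).const_sub 1).cpow_half hw

theorem hasDerivAt_cosArcsinSqrt (s : ℂ) {w : ℂ} (hw : w ∈ hypergeometricDomain) :
    HasDerivAt (cosArcsinSqrt s) (deriv (cosArcsinSqrt s) w) w :=
  ((differentiableOn_cosArcsinSqrt s).differentiableAt
    (isOpen_hypergeometricDomain.mem_nhds hw)).hasDerivAt

theorem hasDerivAt_deriv_cosArcsinSqrt (s : ℂ) {w : ℂ} (hw : w ∈ hypergeometricDomain) :
    HasDerivAt (deriv (cosArcsinSqrt s)) (deriv (deriv (cosArcsinSqrt s)) w) w :=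
  ((differentiableOn_deriv_cosArcsinSqrt s).differentiableAt
    (isOpen_hypergeometricDomain.mem_nhds hw)).hasDerivAt

theorem hasDerivAt_deriv_deriv_cosArcsinSqrt (s : ℂ) {w : ℂ} (hw : w ∈ hypergeometricDomain) :
    HasDerivAt (deriv (deriv (cosArcsinSqrt s))) (deriv (deriv (deriv (cosArcsinSqrt s))) w) w :=
  (((differentiableOn_deriv_cosArcsinSqrt s).deriv isOpen_hypergeometricDomain).differentiableAt
    (isOpen_hypergeometricDomain.mem_nhds hw)).hasDerivAt

/-- The derivative of `cosArcsinSqrt` satisfies the differentiated hypergeometric equation. -/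
theorem deriv_cosArcsinSqrt_ode (s : ℂ) {w : ℂ} (hw : w ∈ hypergeometricDomain) :
    w * (1 - w) * deriv (deriv (deriv (cosArcsinSqrt s))) w +
      (3 / 2 - 3 * w) * deriv (deriv (cosArcsinSqrt s)) w +
      (s ^ 2 - 1) * deriv (cosArcsinSqrt s) w = 0 := by
  have h := ((((hasDerivAt_id' w).fun_mul ((hasDerivAt_id' w).const_sub 1)).fun_mul
    (hasDerivAt_deriv_deriv_cosArcsinSqrt s hw)).fun_add
    (((hasDerivAt_id' w).const_sub (1 / 2)).fun_mul (hasDerivAt_deriv_cosArcsinSqrt s hw))).fun_add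
    ((hasDerivAt_cosArcsinSqrt s hw).const_mul (s ^ 2))
  have hev : (fun w => w * (1 - w) * deriv (deriv (cosArcsinSqrt s)) w +
      (1 / 2 - w) * deriv (cosArcsinSqrt s) w + s ^ 2 * cosArcsinSqrt s w) =ᶠ[nhds w]
        fun _ => 0 := by
    filter_upwards [isOpen_hypergeometricDomain.mem_nhds hw] with u hu using cosArcsinSqrt_ode s hu
  have := (h.congr_of_eventuallyEq hev.symm).unique (hasDerivAt_const w 0)
  linear_combination this

/-! ### Closed forms of three hypergeometric functions -/

theorem hypergeometricF_half_sub_half_add_half (s : ℂ) {w : ℂ} (hw : w ∈ hypergeometricDomain) :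
    hypergeometricF (1 / 2 - s) (1 / 2 + s) (1 / 2) w =
      cosArcsinSqrt s w / (1 - w) ^ (1 / 2 : ℂ) := by
  refine hypergeometricF_eq_of_hasDerivAt
    (f := fun w => cosArcsinSqrt s w / (1 - w) ^ (1 / 2 : ℂ))
    (f' := fun w => deriv (cosArcsinSqrt s) w / (1 - w) ^ (1 / 2 : ℂ) +
      cosArcsinSqrt s w / (2 * ((1 - w) ^ (1 / 2 : ℂ)) ^ 3))
    (f'' := fun w => deriv (deriv (cosArcsinSqrt s)) w / (1 - w) ^ (1 / 2 : ℂ) +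
      deriv (cosArcsinSqrt s) w / ((1 - w) ^ (1 / 2 : ℂ)) ^ 3 +
      3 * cosArcsinSqrt s w / (4 * ((1 - w) ^ (1 / 2 : ℂ)) ^ 5))
    (fun k => ?_) (fun w hw => ?_) (fun w hw => ?_) ?_ (fun w hw => ?_) hw
  · intro h
    have := congrArg Complex.re h
    norm_num at this
    have hk : (0 : ℝ) ≤ k := k.cast_nonneg
    linarith
  · have hq := Complex.cpow_half_ne_zero hw
    refine ((hasDerivAt_cosArcsinSqrt s hw).fun_div (hasDerivAt_sqrt_one_sub hw) hq).congr_deriv ?_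
    generalize (1 - w) ^ (1 / 2 : ℂ) = q at *
    field_simp
    ring
  · have hq := Complex.cpow_half_ne_zero hw
    refine (((hasDerivAt_deriv_cosArcsinSqrt s hw).fun_div (hasDerivAt_sqrt_one_sub hw) hq).fun_add
      ((hasDerivAt_cosArcsinSqrt s hw).fun_div
        (((hasDerivAt_sqrt_one_sub hw).fun_pow 3).const_mul 2)
        (mul_ne_zero two_ne_zero (pow_ne_zero 3 hq)))).congr_deriv ?_
    generalize (1 - w) ^ (1 / 2 : ℂ) = q at *
    field_simp
    ring
  · simp [cosArcsinSqrt_zero]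
  · have hq := Complex.cpow_half_ne_zero hw
    have hqq := Complex.cpow_half_sq (1 - w)
    have h := cosArcsinSqrt_ode s hw
    generalize (1 - w) ^ (1 / 2 : ℂ) = q at *
    -- With q = √(1 - w) as the variable, Gauss's equation becomes a rational identity modulo the
    -- equation for `cosArcsinSqrt`.
    obtain rfl : w = 1 - q ^ 2 := by linear_combination hqq
    field_simp
    linear_combination 16 * q ^ 4 * h

/-- With w = sin²θ the right side is sin(2sθ)/(2s sin θ), written through the derivative so that no
division by sin θ occurs. -/
theorem hypergeometricF_half_sub_half_add_three_half {s : ℂ} (hs : s ≠ 0) {w : ℂ}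
    (hw : w ∈ hypergeometricDomain) :
    hypergeometricF (1 / 2 - s) (1 / 2 + s) (3 / 2) w =
      -(1 - w) ^ (1 / 2 : ℂ) * deriv (cosArcsinSqrt s) w / (2 * s ^ 2) := by
  refine hypergeometricF_eq_of_hasDerivAt
    (f := fun w => -(1 - w) ^ (1 / 2 : ℂ) * deriv (cosArcsinSqrt s) w / (2 * s ^ 2))
    (f' := fun w => (deriv (cosArcsinSqrt s) w / (2 * (1 - w) ^ (1 / 2 : ℂ)) -
      (1 - w) ^ (1 / 2 : ℂ) * deriv (deriv (cosArcsinSqrt s)) w) / (2 * s ^ 2))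
    (f'' := fun w => (deriv (deriv (cosArcsinSqrt s)) w / (1 - w) ^ (1 / 2 : ℂ) +
      deriv (cosArcsinSqrt s) w / (4 * ((1 - w) ^ (1 / 2 : ℂ)) ^ 3) -
      (1 - w) ^ (1 / 2 : ℂ) * deriv (deriv (deriv (cosArcsinSqrt s))) w) / (2 * s ^ 2))
    (fun k => ?_) (fun w hw => ?_) (fun w hw => ?_) ?_ (fun w hw => ?_) hw
  · intro h
    have := congrArg Complex.re h
    norm_num at this
    have hk : (0 : ℝ) ≤ k := k.cast_nonneg
    linarith
  · have hq := Complex.cpow_half_ne_zero hw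
    refine (((hasDerivAt_sqrt_one_sub hw).fun_neg.fun_mul
      (hasDerivAt_deriv_cosArcsinSqrt s hw)).div_const _).congr_deriv ?_
    generalize (1 - w) ^ (1 / 2 : ℂ) = q at *
    field_simp
    ring
  · have hq := Complex.cpow_half_ne_zero hw
    refine ((((hasDerivAt_deriv_cosArcsinSqrt s hw).fun_div
      ((hasDerivAt_sqrt_one_sub hw).const_mul 2) (mul_ne_zero two_ne_zero hq)).fun_sub
      ((hasDerivAt_sqrt_one_sub hw).fun_mul
        (hasDerivAt_deriv_deriv_cosArcsinSqrt s hw))).div_const _).congr_deriv ?_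
    generalize (1 - w) ^ (1 / 2 : ℂ) = q at *
    field_simp
    ring
  -- At w = 0 the second-order term drops out and the equation gives the derivative -2s², which
  -- explains the normalisation.
  · have h := cosArcsinSqrt_ode s zero_mem_hypergeometricDomain
    rw [cosArcsinSqrt_zero] at h
    simp only [sub_zero, Complex.one_cpow]
    field_simp
    linear_combination -2 * h
  · have hq := Complex.cpow_half_ne_zero hw
    have hqq := Complex.cpow_half_sq (1 - w)
    have h := cosArcsinSqrt_ode s hw
    have h' := deriv_cosArcsinSqrt_ode s hw
    generalize (1 - w) ^ (1 / 2 : ℂ) = q at *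
    obtain rfl : w = 1 - q ^ 2 := by linear_combination hqq
    field_simp
    linear_combination -16 * q ^ 4 * h'

/-- The classical elementary case F(α, α + 1/2; 2α; w) with α = (s + 1)/2; at w = 1/z² it yields Q
on the plane cut along (-∞, 1]. -/
theorem hypergeometricF_quadratic {s : ℂ} (hs : ∀ k : ℕ, s + 1 + k ≠ 0) {w : ℂ}
    (hw : w ∈ hypergeometricDomain) :
    hypergeometricF ((s + 1) / 2) ((s + 2) / 2) (s + 1) w =
      ((1 + (1 - w) ^ (1 / 2 : ℂ)) / 2) ^ (-s) / (1 - w) ^ (1 / 2 : ℂ) := by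
  -- The principal root has positive real part, so the base of the power -s stays in the right
  -- half-plane.
  have hmem : ∀ w ∈ hypergeometricDomain,
      (1 + (1 - w) ^ (1 / 2 : ℂ)) / 2 ∈ Complex.slitPlane := by
    intro w hw
    left
    have := Complex.re_cpow_half_pos hw
    rw [show (1 + (1 - w) ^ (1 / 2 : ℂ)) / 2 = ((1 / 2 : ℝ) : ℂ) * (1 + (1 - w) ^ (1 / 2 : ℂ)) by
      push_cast; ring, Complex.re_ofReal_mul, Complex.add_re, Complex.one_re]
    positivity
  have hd : ∀ w ∈ hypergeometricDomain,
      HasDerivAt (fun w : ℂ => ((1 + (1 - w) ^ (1 / 2 : ℂ)) / 2) ^ (-s))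
        (s * ((1 + (1 - w) ^ (1 / 2 : ℂ)) / 2) ^ (-s) /
          (2 * (1 - w) ^ (1 / 2 : ℂ) * (1 + (1 - w) ^ (1 / 2 : ℂ)))) w := by
    intro w hw
    have hq := Complex.cpow_half_ne_zero hw
    have hm := hmem w hw
    have h0 := Complex.slitPlane_ne_zero hm
    refine ((((hasDerivAt_sqrt_one_sub hw).const_add 1).div_const 2).cpow_const
      (c := -s) hm).congr_deriv ?_
    rw [Complex.cpow_sub _ _ h0, Complex.cpow_one]
    generalize ((1 + (1 - w) ^ (1 / 2 : ℂ)) / 2) ^ (-s) = t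
    generalize (1 - w) ^ (1 / 2 : ℂ) = q at *
    have h1 : 1 + q ≠ 0 := fun h => h0 (by rw [h]; simp)
    field_simp
  refine hypergeometricF_eq_of_hasDerivAt
    (f := fun w => ((1 + (1 - w) ^ (1 / 2 : ℂ)) / 2) ^ (-s) / (1 - w) ^ (1 / 2 : ℂ))
    (f' := fun w => ((1 + (1 - w) ^ (1 / 2 : ℂ)) / 2) ^ (-s) *
      (1 + (s + 1) * (1 - w) ^ (1 / 2 : ℂ)) /
        (2 * ((1 - w) ^ (1 / 2 : ℂ)) ^ 3 * (1 + (1 - w) ^ (1 / 2 : ℂ))))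
    (f'' := fun w => ((1 + (1 - w) ^ (1 / 2 : ℂ)) / 2) ^ (-s) *
      (3 + (3 * s + 6) * (1 - w) ^ (1 / 2 : ℂ) + (s + 1) * (s + 3) * ((1 - w) ^ (1 / 2 : ℂ)) ^ 2) /
        (4 * ((1 - w) ^ (1 / 2 : ℂ)) ^ 5 * (1 + (1 - w) ^ (1 / 2 : ℂ)) ^ 2))
    hs (fun w hw => ?_) (fun w hw => ?_) ?_ (fun w hw => ?_) hw
  · have hq := Complex.cpow_half_ne_zero hw
    have h0 := Complex.slitPlane_ne_zero (hmem w hw)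
    refine ((hd w hw).fun_div (hasDerivAt_sqrt_one_sub hw) hq).congr_deriv ?_
    generalize ((1 + (1 - w) ^ (1 / 2 : ℂ)) / 2) ^ (-s) = t
    generalize (1 - w) ^ (1 / 2 : ℂ) = q at *
    have h1 : 1 + q ≠ 0 := fun h => h0 (by rw [h]; simp)
    field_simp
    ring
  · have hq := Complex.cpow_half_ne_zero hw
    have h0 := Complex.slitPlane_ne_zero (hmem w hw)
    have h1 : 1 + (1 - w) ^ (1 / 2 : ℂ) ≠ 0 := fun h => h0 (by rw [h]; simp)
    have hq' := hasDerivAt_sqrt_one_sub hw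
    refine (((hd w hw).fun_mul ((hq'.const_mul (s + 1)).const_add 1)).fun_div
      (((hq'.fun_pow 3).const_mul 2).fun_mul (hq'.const_add 1))
      (mul_ne_zero (mul_ne_zero two_ne_zero (pow_ne_zero 3 hq)) h1)).congr_deriv ?_
    generalize ((1 + (1 - w) ^ (1 / 2 : ℂ)) / 2) ^ (-s) = t
    generalize (1 - w) ^ (1 / 2 : ℂ) = q at *
    field_simp
    ring
  · norm_num
  · have hq := Complex.cpow_half_ne_zero hw
    have hqq := Complex.cpow_half_sq (1 - w)
    have h0 := Complex.slitPlane_ne_zero (hmem w hw)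
    generalize ((1 + (1 - w) ^ (1 / 2 : ℂ)) / 2) ^ (-s) = t
    generalize (1 - w) ^ (1 / 2 : ℂ) = q at *
    have h1 : 1 + q ≠ 0 := fun h => h0 (by rw [h]; simp)
    obtain rfl : w = 1 - q ^ 2 := by linear_combination hqq
    field_simp
    ring

/-! ### Linearity, Wronskians and the solution space of the differential equation -/

theorem dicksonOperator_congr {n : ℕ} {a : ℂ} {V : Set ℂ} (hV : IsOpen V) {F G : ℂ → ℂ}
    (h : ∀ x ∈ V, F x = G x) {x : ℂ} (hx : x ∈ V) :
    dicksonOperator n a F x = dicksonOperator n a G x := by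
  have h1 : F =ᶠ[nhds x] G := by filter_upwards [hV.mem_nhds hx] with y hy using h y hy
  unfold dicksonOperator
  rw [h1.deriv.deriv_eq, h1.deriv_eq, h1.eq_of_nhds]

theorem dicksonOperator_linear {n : ℕ} {a : ℂ} {V : Set ℂ} (hV : IsOpen V) {f g : ℂ → ℂ}
    (hf : DifferentiableOn ℂ f V) (hg : DifferentiableOn ℂ g V) (A B : ℂ) {x : ℂ} (hx : x ∈ V) :
    dicksonOperator n a (fun y => A * f y + B * g y) x =
      A * dicksonOperator n a f x + B * dicksonOperator n a g x := by
  have hd : ∀ {f : ℂ → ℂ}, DifferentiableOn ℂ f V → ∀ y ∈ V, HasDerivAt f (deriv f y) y :=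
    fun hf y hy => (hf.differentiableAt (hV.mem_nhds hy)).hasDerivAt
  have h1 : ∀ y ∈ V, deriv (fun y => A * f y + B * g y) y = A * deriv f y + B * deriv g y :=
    fun y hy => (((hd hf y hy).const_mul A).fun_add ((hd hg y hy).const_mul B)).deriv
  have h2 : deriv (fun y => A * f y + B * g y) =ᶠ[nhds x]
      fun y => A * deriv f y + B * deriv g y := by
    filter_upwards [hV.mem_nhds hx] with y hy using h1 y hy
  unfold dicksonOperator
  rw [h2.deriv_eq, h1 x hx, (((hd (hf.deriv hV) x hx).const_mul A).fun_add
    ((hd (hg.deriv hV) x hx).const_mul B)).deriv]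
  ring

theorem IsHomogeneousSolution.of_hasDerivAt {n : ℕ} {a : ℂ} {V : Set ℂ} (hV : IsOpen V)
    {y y' y'' : ℂ → ℂ} (h : ∀ x ∈ V, HasDerivAt y (y' x) x) (h' : ∀ x ∈ V, HasDerivAt y' (y'' x) x)
    (hode : ∀ x ∈ V, (x ^ 2 - 4 * a) * y'' x + 3 * x * y' x - (n : ℂ) ^ 2 * y x = 0) :
    IsHomogeneousSolution n a V y := by
  refine ⟨fun x hx => (h x hx).differentiableAt.differentiableWithinAt, fun x hx => ?_⟩
  have h1 : deriv y =ᶠ[nhds x] y' := by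
    filter_upwards [hV.mem_nhds hx] with u hu using (h u hu).deriv
  unfold dicksonOperator
  rw [h1.deriv_eq, (h' x hx).deriv, (h x hx).deriv]
  exact hode x hx

/-- Abel's identity: the logarithmic derivative of the Wronskian does not depend on the pair of
solutions. -/
theorem IsHomogeneousSolution.hasDerivAt_wronskian {n : ℕ} {a : ℂ} {V : Set ℂ} (hV : IsOpen V)
    (hne : ∀ x ∈ V, x ^ 2 - 4 * a ≠ 0) {f g : ℂ → ℂ} (hf : IsHomogeneousSolution n a V f)
    (hg : IsHomogeneousSolution n a V g) {x : ℂ} (hx : x ∈ V) :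
    HasDerivAt (fun x => f x * deriv g x - deriv f x * g x)
      (-(3 * x / (x ^ 2 - 4 * a)) * (f x * deriv g x - deriv f x * g x)) x := by
  have hd : ∀ {f : ℂ → ℂ}, DifferentiableOn ℂ f V → HasDerivAt f (deriv f x) x :=
    fun hf => (hf.differentiableAt (hV.mem_nhds hx)).hasDerivAt
  refine (((hd hf.1).fun_mul (hd (hg.1.deriv hV))).fun_sub
    ((hd (hf.1.deriv hV)).fun_mul (hd hg.1))).congr_deriv ?_
  have e1 := hf.2 x hx
  have e2 := hg.2 x hx
  unfold dicksonOperator at e1 e2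
  have := hne x hx
  field_simp
  linear_combination f x * e2 - g x * e1

/-- Two solutions with nonvanishing Wronskian span the solutions of the homogeneous equation. -/
theorem isHomogeneousSolution_iff_of_wronskian_ne_zero {n : ℕ} {a : ℂ} {V : Set ℂ} (hV : IsOpen V)
    (hVc : IsPreconnected V) (hne : ∀ x ∈ V, x ^ 2 - 4 * a ≠ 0) {f g : ℂ → ℂ}
    (hf : IsHomogeneousSolution n a V f) (hg : IsHomogeneousSolution n a V g)
    (hW : ∀ x ∈ V, f x * deriv g x - deriv f x * g x ≠ 0) (F : ℂ → ℂ) :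
    IsHomogeneousSolution n a V F ↔ ∃ A B : ℂ, ∀ x ∈ V, F x = A * f x + B * g x := by
  constructor
  · intro hF
    rcases V.eq_empty_or_nonempty with rfl | ⟨x₀, hx₀⟩
    · exact ⟨0, 0, by simp⟩
    -- All Wronskians satisfy one first-order linear equation, so their quotients are constant on
    -- the connected set.
    have hconst : ∀ {u v : ℂ → ℂ}, IsHomogeneousSolution n a V u → IsHomogeneousSolution n a V v →
        ∀ x ∈ V, (u x * deriv v x - deriv u x * v x) / (f x * deriv g x - deriv f x * g x) =
          (u x₀ * deriv v x₀ - deriv u x₀ * v x₀) /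
            (f x₀ * deriv g x₀ - deriv f x₀ * g x₀) := by
      intro u v hu hv x hx
      have hder : ∀ x ∈ V, HasDerivAt (fun x => (u x * deriv v x - deriv u x * v x) /
          (f x * deriv g x - deriv f x * g x)) 0 x := by
        intro x hx
        refine ((hu.hasDerivAt_wronskian hV hne hv hx).fun_div
          (hf.hasDerivAt_wronskian hV hne hg hx) (hW x hx)).congr_deriv ?_
        rw [div_eq_zero_iff]
        left
        ring
      exact hV.is_const_of_deriv_eq_zero hVc
        (fun x hx => (hder x hx).differentiableAt.differentiableWithinAt)
        (fun x hx => (hder x hx).deriv) hx hx₀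
    -- Cramer's rule for F = Af + Bg, F' = Af' + Bg' at the base point.
    refine ⟨(F x₀ * deriv g x₀ - deriv F x₀ * g x₀) / (f x₀ * deriv g x₀ - deriv f x₀ * g x₀),
      (f x₀ * deriv F x₀ - deriv f x₀ * F x₀) / (f x₀ * deriv g x₀ - deriv f x₀ * g x₀),
      fun x hx => ?_⟩
    rw [← hconst hF hg x hx, ← hconst hf hF x hx]
    rw [div_mul_eq_mul_div, div_mul_eq_mul_div, ← add_div, eq_div_iff (hW x hx)]
    ring
  · rintro ⟨A, B, h⟩
    refine ⟨(((hf.1.const_mul A).add (hg.1.const_mul B))).congr h, fun x hx => ?_⟩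
    rw [dicksonOperator_congr hV h hx, dicksonOperator_linear hV hf.1 hg.1 A B hx, hf.2 x hx,
      hg.2 x hx]
    simp

theorem isInhomogeneousSolution_iff_sub {n : ℕ} {a : ℂ} {V : Set ℂ} (hV : IsOpen V)
    {G : ℂ → ℂ} (hG : IsInhomogeneousSolution n a V G) (F : ℂ → ℂ) :
    IsInhomogeneousSolution n a V F ↔ IsHomogeneousSolution n a V (fun x => F x - G x) := by
  constructor
  · intro hF
    refine ⟨hF.1.sub hG.1, fun x hx => ?_⟩
    have := dicksonOperator_linear (n := n) (a := a) hV hF.1 hG.1 1 (-1) hx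
    rw [dicksonOperator_congr hV (G := fun y => 1 * F y + -1 * G y) (fun y _ => by ring) hx, this,
      hF.2 x hx, hG.2 x hx]
    ring
  · intro hF
    have e : ∀ y ∈ V, F y = 1 * (F y - G y) + 1 * G y := fun y _ => by ring
    refine ⟨(hF.1.add hG.1).congr fun y _ => by simp, fun x hx => ?_⟩
    rw [dicksonOperator_congr hV e hx, dicksonOperator_linear hV hF.1 hG.1 1 1 hx,
      hF.2 x hx, hG.2 x hx]
    ring

/-! ### Branches of fourth roots and the reduction to Chebyshev's equation -/

/-- A continuous branch of the fourth root of a holomorphic function is holomorphic where it does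
not vanish. -/
theorem HasDerivAt.of_pow_four_eq {u h : ℂ → ℂ} {h' x : ℂ} (hh : HasDerivAt h h' x)
    (hu : ContinuousAt u x) (huh : ∀ᶠ y in nhds x, u y ^ 4 = h y) (hx : u x ≠ 0) :
    HasDerivAt u (h' / (4 * u x ^ 3)) x := by
  rw [hasDerivAt_iff_tendsto_slope] at hh ⊢
  -- This is the cofactor of u(y) - u(x) in u(y)⁴ - u(x)⁴; dividing the slope of h by it gives the
  -- slope of u.
  have hS : Filter.Tendsto (fun y => u y ^ 3 + u y ^ 2 * u x + u y * u x ^ 2 + u x ^ 3)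
      (nhdsWithin x {x}ᶜ) (nhds (4 * u x ^ 3)) := by
    have hc : ContinuousAt (fun y => u y ^ 3 + u y ^ 2 * u x + u y * u x ^ 2 + u x ^ 3) x := by
      fun_prop
    have := hc.tendsto
    rw [show u x ^ 3 + u x ^ 2 * u x + u x * u x ^ 2 + u x ^ 3 = 4 * u x ^ 3 by ring] at this
    exact this.mono_left nhdsWithin_le_nhds
  have h4 : 4 * u x ^ 3 ≠ 0 := mul_ne_zero (by norm_num) (pow_ne_zero 3 hx)
  refine (hh.div hS h4).congr' ?_
  filter_upwards [hS.eventually_ne h4, huh.filter_mono nhdsWithin_le_nhds, self_mem_nhdsWithin]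
    with y hy1 hy2 hy3
  have hyx : y - x ≠ 0 := sub_ne_zero.2 hy3
  simp only [Pi.div_apply, slope_def_field]
  rw [← hy2, ← huh.self_of_nhds, div_div, div_eq_div_iff (mul_ne_zero hyx hy1) hyx]
  ring

/-- Such an e is a branch of a multiple of (x² - 4a)^{-1/2}, and its logarithmic derivative is the
same for every branch. -/
theorem hasDerivAt_of_pow_four_mul_sq_eq {a c : ℂ} (hc : c ≠ 0) {V : Set ℂ} (hV : IsOpen V)
    (hne : ∀ x ∈ V, x ^ 2 - 4 * a ≠ 0) {e : ℂ → ℂ} (he : ContinuousOn e V)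
    (h4 : ∀ x ∈ V, e x ^ 4 = c / (x ^ 2 - 4 * a) ^ 2) {x : ℂ} (hx : x ∈ V) :
    HasDerivAt e (-(x / (x ^ 2 - 4 * a)) * e x) x := by
  have hX := hne x hx
  have hex : e x ≠ 0 := by
    intro h
    have := h4 x hx
    rw [h, zero_pow (by norm_num), eq_comm, div_eq_zero_iff] at this
    exact this.elim hc (pow_ne_zero 2 hX)
  have hd := (hasDerivAt_const x c).fun_div
    ((((hasDerivAt_pow 2 x).sub_const (4 * a))).fun_pow 2) (pow_ne_zero 2 hX)
  refine (hd.of_pow_four_eq (he.continuousAt (hV.mem_nhds hx))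
    (by filter_upwards [hV.mem_nhds hx] with y hy using h4 y hy) hex).congr_deriv ?_
  have h := h4 x hx
  rw [eq_div_iff (pow_ne_zero 2 hX)] at h
  rw [← h]
  push_cast
  field_simp
  ring

section
variable {n : ℕ} {a r : ℂ} {V : Set ℂ} {e p p' p'' : ℂ → ℂ}

theorem hasDerivAt_comp_div_two_mul {x : ℂ} {c : ℂ} (hp : HasDerivAt p c (x / (2 * r))) :
    HasDerivAt (fun x => p (x / (2 * r))) (c / (2 * r)) x := by
  have := hp.comp x ((hasDerivAt_id' x).div_const (2 * r))
  refine this.congr_deriv ?_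
  ring

theorem hasDerivAt_mul_chebyshev
    (he : ∀ x ∈ V, HasDerivAt e (-(x / (x ^ 2 - 4 * a)) * e x) x)
    (hp : ∀ x ∈ V, HasDerivAt p (p' (x / (2 * r))) (x / (2 * r))) {x : ℂ} (hx : x ∈ V) :
    HasDerivAt (fun x => e x * p (x / (2 * r)))
      (e x * (p' (x / (2 * r)) / (2 * r) - x / (x ^ 2 - 4 * a) * p (x / (2 * r)))) x := by
  refine ((he x hx).fun_mul (hasDerivAt_comp_div_two_mul (hp x hx))).congr_deriv ?_
  ring

/-- If `p` solves `(z² - 1) p'' + z p' = (n² + 1) p`, then `p(x / 2√a) / √(x² - 4a)` solves the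
homogeneous equation. -/
theorem isHomogeneousSolution_mul_chebyshev (hV : IsOpen V) (hr : r ^ 2 = a) (hr0 : r ≠ 0)
    (hne : ∀ x ∈ V, x ^ 2 - 4 * a ≠ 0)
    (he : ∀ x ∈ V, HasDerivAt e (-(x / (x ^ 2 - 4 * a)) * e x) x)
    (hp : ∀ x ∈ V, HasDerivAt p (p' (x / (2 * r))) (x / (2 * r)))
    (hp' : ∀ x ∈ V, HasDerivAt p' (p'' (x / (2 * r))) (x / (2 * r)))
    (hode : ∀ x ∈ V, ((x / (2 * r)) ^ 2 - 1) * p'' (x / (2 * r)) + x / (2 * r) * p' (x / (2 * r)) =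
      ((n : ℂ) ^ 2 + 1) * p (x / (2 * r))) :
    IsHomogeneousSolution n a V (fun x => e x * p (x / (2 * r))) := by
  refine IsHomogeneousSolution.of_hasDerivAt hV
    (fun x hx => hasDerivAt_mul_chebyshev he hp hx)
    (fun x hx => (he x hx).fun_mul (((hasDerivAt_comp_div_two_mul (hp' x hx)).div_const _).fun_sub
      (((hasDerivAt_id' x).fun_div ((hasDerivAt_pow 2 x).sub_const (4 * a)) (hne x hx)).fun_mul
        (hasDerivAt_comp_div_two_mul (hp x hx))))) (fun x hx => ?_)
  have h := hode x hx
  have hX := hne x hx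
  subst hr
  obtain ⟨z, rfl⟩ : ∃ z, x = 2 * r * z := ⟨x / (2 * r), by field_simp⟩
  have hz : 2 * r * z / (2 * r) = z := by field_simp
  simp only [hz] at h ⊢
  generalize e (2 * r * z) = E at *
  generalize p z = P at *
  generalize p' z = P' at *
  generalize p'' z = P'' at *
  have hz1 : z ^ 2 - 1 ≠ 0 := fun h0 => hX (by linear_combination 4 * r ^ 2 * h0)
  have hX' : (2 * r * z) ^ 2 - 4 * r ^ 2 = 4 * r ^ 2 * (z ^ 2 - 1) := by ring
  simp only [hX']
  push_cast
  field_simp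
  linear_combination 16 * E * (z ^ 2 - 1) * h
end

/-! ### Geometry of the cut planes -/

theorem Complex.mem_slitPlane_of_forall_ne {u : ℂ} (h : ∀ t : ℝ, 0 ≤ t → u ≠ -(t : ℂ)) :
    u ∈ Complex.slitPlane := by
  by_contra hu
  rw [Complex.mem_slitPlane_iff] at hu
  push Not at hu
  exact h (-u.re) (by linarith) (Complex.ext (by simp) (by simpa using hu.2))

theorem Complex.neg_ofReal_notMem_slitPlane {t : ℝ} (ht : 0 ≤ t) :
    -(t : ℂ) ∉ Complex.slitPlane := by
  rw [Complex.mem_slitPlane_iff]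
  simpa using ht

theorem Complex.cpow_half_half_pow_four (u : ℂ) : (u ^ (1 / 2 / 2 : ℂ)) ^ 4 = u := by
  rw [← Complex.cpow_mul_nat]
  norm_num

theorem half_mem_slitPlane {u : ℂ} (hu : u ∈ Complex.slitPlane) : u / 2 ∈ Complex.slitPlane := by
  refine Complex.mem_slitPlane_of_forall_ne fun t ht h => ?_
  refine Complex.neg_ofReal_notMem_slitPlane (t := 2 * t) (by positivity) ?_
  rwa [show -((2 * t : ℝ) : ℂ) = u by push_cast; linear_combination -2 * h]

theorem legendreDomain_add_mem {z : ℂ} (hz : z ∈ legendreDomain) {c : ℝ} (hc : -1 ≤ c) :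
    z + c ∈ Complex.slitPlane := by
  have h : z - 1 ∈ Complex.slitPlane := hz
  rw [Complex.mem_slitPlane_iff] at h ⊢
  simp only [Complex.sub_re, Complex.one_re, Complex.sub_im, Complex.one_im, sub_zero,
    Complex.add_re, Complex.add_im, Complex.ofReal_re, Complex.ofReal_im, add_zero] at h ⊢
  exact h.imp (fun h => by linarith) id

theorem legendreDomain_mem_slitPlane {z : ℂ} (hz : z ∈ legendreDomain) : z ∈ Complex.slitPlane := by
  simpa using legendreDomain_add_mem hz (c := 0) (by norm_num)

theorem legendreDomain_add_one_mem {z : ℂ} (hz : z ∈ legendreDomain) :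
    z + 1 ∈ Complex.slitPlane := by
  simpa using legendreDomain_add_mem hz (c := 1) (by norm_num)

theorem legendreDomain_one_sub_half_mem {z : ℂ} (hz : z ∈ legendreDomain) :
    (1 - z) / 2 ∈ hypergeometricDomain := by
  change 1 - (1 - z) / 2 ∈ Complex.slitPlane
  rw [show 1 - (1 - z) / 2 = (z + 1) / 2 by ring]
  exact half_mem_slitPlane (legendreDomain_add_one_mem hz)

theorem legendreDomain_div_mem {z : ℂ} (hz : z ∈ legendreDomain) :
    (z + 1) / (z - 1) ∈ Complex.slitPlane := by
  have h : z - 1 ∈ Complex.slitPlane := hz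
  have h0 := Complex.slitPlane_ne_zero h
  refine Complex.mem_slitPlane_of_forall_ne fun t ht he => ?_
  have ht1 : (1 + (t : ℂ)) ≠ 0 := by
    exact_mod_cast (by positivity : (1 + t) ≠ 0)
  refine Complex.neg_ofReal_notMem_slitPlane (t := 2 / (1 + t)) (by positivity) ?_
  rwa [show -((2 / (1 + t) : ℝ) : ℂ) = z - 1 by
    push_cast
    field_simp at he ⊢
    linear_combination -he]

/-- If 1 - 1/z² = -t with t ≥ 0, then z² = 1/(1 + t), so z is real in [-1, 1], which lies on the
cut. -/
theorem legendreDomain_inv_sq_mem {z : ℂ} (hz : z ∈ legendreDomain) :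
    1 / z ^ 2 ∈ hypergeometricDomain := by
  have h : z - 1 ∈ Complex.slitPlane := hz
  have h0 := Complex.slitPlane_ne_zero (legendreDomain_mem_slitPlane hz)
  refine Complex.mem_slitPlane_of_forall_ne fun t ht he => ?_
  have h1 : z ^ 2 * (1 + t) = 1 := by
    field_simp at he
    linear_combination he
  have hre := congrArg Complex.re h1
  have him := congrArg Complex.im h1
  simp [pow_two] at hre him
  rw [Complex.mem_slitPlane_iff] at h
  simp at h
  have ht1 : (1 + t) ≠ 0 := by positivity
  have him' : z.re * z.im = 0 := by
    have := him.resolve_right ht1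
    linarith
  rcases mul_eq_zero.1 him' with h2 | h2
  · rw [h2] at hre
    nlinarith [sq_nonneg z.im]
  · rw [h2] at hre h
    simp at h
    nlinarith

theorem ferrersDomain_one_sub_half_mem {z : ℂ} (hz : z ∈ ferrersDomain) :
    (1 - z) / 2 ∈ hypergeometricDomain := by
  change 1 - (1 - z) / 2 ∈ Complex.slitPlane
  rw [show 1 - (1 - z) / 2 = (1 + z) / 2 by ring]
  exact half_mem_slitPlane hz.2

theorem ferrersDomain_div_mem {z : ℂ} (hz : z ∈ ferrersDomain) :
    (1 + z) / (1 - z) ∈ Complex.slitPlane := by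
  have h := hz.1
  have h0 := Complex.slitPlane_ne_zero h
  refine Complex.mem_slitPlane_of_forall_ne fun t ht he => ?_
  have he' : 1 + z = -(t : ℂ) * (1 - z) := by field_simp at he; linear_combination he
  have h1 := hz.2
  rw [Complex.mem_slitPlane_iff] at h h1
  have hre := congrArg Complex.re he'
  have him := congrArg Complex.im he'
  simp at hre him h h1
  have him0 : z.im * (1 - t) = 0 := by linarith
  -- Either z is real, hence on one of the two cuts, or t = 1, and then the equation reads 1 + z = z
  -- - 1.
  rcases mul_eq_zero.1 him0 with h2 | h2
  · simp [h2] at h h1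
    nlinarith
  · obtain rfl : t = 1 := by linarith
    linarith

theorem ContinuousAt.cpow_of_mem {f : ℂ → ℂ} {z : ℂ} (hf : ContinuousAt f z)
    (h : f z ∈ Complex.slitPlane) (c : ℂ) : ContinuousAt (fun z => f z ^ c) z :=
  hf.cpow continuousAt_const h

/-! ### Elementary forms of the Legendre functions of order 1/2 -/

/-- `P_{s-1/2}^{1/2}(z) = k(z) cos (2s arcsin √((1-z)/2))` with `k` a branch of a multiple of
`(z² - 1)^{-1/4}`. -/
theorem exists_assocLegendreP_eq (s : ℂ) : ∃ κ : ℂ, κ ≠ 0 ∧ ∃ k : ℂ → ℂ, ∀ z ∈ legendreDomain,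
    ContinuousAt k z ∧ k z ^ 4 * (z ^ 2 - 1) = κ ∧
      assocLegendreP (s - 1 / 2) (1 / 2) z = k z * cosArcsinSqrt s ((1 - z) / 2) := by
  have hΓ : Complex.Gamma (1 - 1 / 2) ≠ 0 := Complex.Gamma_ne_zero_of_re_pos (by norm_num)
  refine ⟨4 / Complex.Gamma (1 - 1 / 2) ^ 4, div_ne_zero (by norm_num) (pow_ne_zero 4 hΓ),
    fun z => 1 / Complex.Gamma (1 - 1 / 2) * ((z + 1) / (z - 1)) ^ (1 / 2 / 2 : ℂ) /
      (1 - (1 - z) / 2) ^ (1 / 2 : ℂ), fun z hz => ?_⟩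
  have h1 := Complex.slitPlane_ne_zero (legendreDomain_add_one_mem hz)
  have h2 : z - 1 ≠ 0 := Complex.slitPlane_ne_zero hz
  have hw := legendreDomain_one_sub_half_mem hz
  have hq := Complex.cpow_half_ne_zero hw
  refine ⟨?_, ?_, ?_⟩
  · refine ContinuousAt.div (continuousAt_const.mul (ContinuousAt.cpow_of_mem
      (f := fun z : ℂ => (z + 1) / (z - 1)) ?_ (legendreDomain_div_mem hz) _))
          (ContinuousAt.cpow_of_mem (f := fun z : ℂ => 1 - (1 - z) / 2)
      (by fun_prop) hw _) hq
    exact ContinuousAt.div (by fun_prop) (by fun_prop) h2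
  · have e1 := Complex.cpow_half_half_pow_four ((z + 1) / (z - 1))
    have e2 := Complex.cpow_half_sq (1 - (1 - z) / 2)
    have e3 : ((1 - (1 - z) / 2) ^ (1 / 2 : ℂ)) ^ 4 = ((z + 1) / 2) ^ 2 := by
      rw [show 4 = 2 * 2 by norm_num, pow_mul, e2]; ring
    simp only [div_pow, mul_pow, e1, e3]
    field_simp
    ring
  · unfold assocLegendreP
    rw [show -(s - 1 / 2) = 1 / 2 - s by ring, show s - 1 / 2 + 1 = 1 / 2 + s by ring]
    have := hypergeometricF_half_sub_half_add_half s hw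
    norm_num at this ⊢
    rw [this]
    ring

theorem exists_ferrersP_eq (s : ℂ) : ∃ κ : ℂ, κ ≠ 0 ∧ ∃ k : ℂ → ℂ, ∀ z ∈ ferrersDomain,
    ContinuousAt k z ∧ k z ^ 4 * (z ^ 2 - 1) = κ ∧
      ferrersP (s - 1 / 2) (1 / 2) z = k z * cosArcsinSqrt s ((1 - z) / 2) := by
  have hΓ : Complex.Gamma (1 - 1 / 2) ≠ 0 := Complex.Gamma_ne_zero_of_re_pos (by norm_num)
  refine ⟨-(4 / Complex.Gamma (1 - 1 / 2) ^ 4), neg_ne_zero.2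
      (div_ne_zero (by norm_num) (pow_ne_zero 4 hΓ)),
    fun z => 1 / Complex.Gamma (1 - 1 / 2) * ((1 + z) / (1 - z)) ^ (1 / 2 / 2 : ℂ) /
      (1 - (1 - z) / 2) ^ (1 / 2 : ℂ), fun z hz => ?_⟩
  have h1 := Complex.slitPlane_ne_zero hz.2
  have h2 := Complex.slitPlane_ne_zero hz.1
  have hw := ferrersDomain_one_sub_half_mem hz
  have hq := Complex.cpow_half_ne_zero hw
  refine ⟨?_, ?_, ?_⟩
  · refine ContinuousAt.div (continuousAt_const.mul (ContinuousAt.cpow_of_mem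
      (f := fun z : ℂ => (1 + z) / (1 - z)) ?_ (ferrersDomain_div_mem hz) _))
          (ContinuousAt.cpow_of_mem (f := fun z : ℂ => 1 - (1 - z) / 2)
      (by fun_prop) hw _) hq
    exact ContinuousAt.div (by fun_prop) (by fun_prop) h2
  · have e1 := Complex.cpow_half_half_pow_four ((1 + z) / (1 - z))
    have e2 := Complex.cpow_half_sq (1 - (1 - z) / 2)
    have e3 : ((1 - (1 - z) / 2) ^ (1 / 2 : ℂ)) ^ 4 = ((1 + z) / 2) ^ 2 := by
      rw [show 4 = 2 * 2 by norm_num, pow_mul, e2]; ring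
    simp only [div_pow, mul_pow, e1, e3]
    field_simp
    ring
  · unfold ferrersP
    rw [show -(s - 1 / 2) = 1 / 2 - s by ring, show s - 1 / 2 + 1 = 1 / 2 + s by ring]
    have := hypergeometricF_half_sub_half_add_half s hw
    norm_num at this ⊢
    rw [this]
    ring

/-- The Ferrers function is `Q_{s-1/2}^{1/2}(z) = k(z) F(z)`, with `k` a branch of a multiple of
`(z² - 1)^{1/4}` and `F` the derivative of `cos (2s arcsin √w)` at `w = (1-z)/2`. -/
theorem exists_ferrersQ_eq {s : ℂ} (hs : 0 < s.re) : ∃ κ : ℂ, κ ≠ 0 ∧ ∃ k : ℂ → ℂ,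
    ∀ z ∈ ferrersDomain, ContinuousAt k z ∧ k z ^ 4 = κ * (z ^ 2 - 1) ∧
      ferrersQ (s - 1 / 2) (1 / 2) z = k z * deriv (cosArcsinSqrt s) ((1 - z) / 2) := by
  have hs0 : s ≠ 0 := by rintro rfl; simp at hs
  have hΓ : Complex.Gamma (3 / 2) ≠ 0 := Complex.Gamma_ne_zero_of_re_pos (by norm_num)
  have hΓs : Complex.Gamma s ≠ 0 := Complex.Gamma_ne_zero_of_re_pos hs
  have hπ : (Real.pi : ℂ) ≠ 0 := by exact_mod_cast Real.pi_ne_zero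
  set c : ℂ := Real.pi / (4 * s * Complex.Gamma (3 / 2)) with hc
  have hc0 : c ≠ 0 := by
    rw [hc]; exact div_ne_zero hπ (mul_ne_zero (mul_ne_zero (by norm_num) hs0) hΓ)
  refine ⟨-(c ^ 4 / 4), neg_ne_zero.2 (div_ne_zero (pow_ne_zero 4 hc0) (by norm_num)),
    fun z => c * (1 - (1 - z) / 2) ^ (1 / 2 : ℂ) / ((1 + z) / (1 - z)) ^ (1 / 2 / 2 : ℂ),
    fun z hz => ?_⟩
  have h1 := Complex.slitPlane_ne_zero hz.2
  have h2 := Complex.slitPlane_ne_zero hz.1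
  have hw := ferrersDomain_one_sub_half_mem hz
  have hm := ferrersDomain_div_mem hz
  have hm0 : ((1 + z) / (1 - z)) ^ (1 / 2 / 2 : ℂ) ≠ 0 := by
    rw [Ne, Complex.cpow_eq_zero_iff]
    exact fun h => Complex.slitPlane_ne_zero hm h.1
  refine ⟨?_, ?_, ?_⟩
  · refine ContinuousAt.div (continuousAt_const.mul
      (ContinuousAt.cpow_of_mem (f := fun z : ℂ => 1 - (1 - z) / 2)
      (by fun_prop) hw _)) (ContinuousAt.cpow_of_mem
      (f := fun z : ℂ => (1 + z) / (1 - z)) ?_ hm _) hm0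
    exact ContinuousAt.div (by fun_prop) (by fun_prop) h2
  · have e1 := Complex.cpow_half_half_pow_four ((1 + z) / (1 - z))
    have e2 := Complex.cpow_half_sq (1 - (1 - z) / 2)
    have e3 : ((1 - (1 - z) / 2) ^ (1 / 2 : ℂ)) ^ 4 = ((1 + z) / 2) ^ 2 := by
      rw [show 4 = 2 * 2 by norm_num, pow_mul, e2]; ring
    simp only [div_pow, mul_pow, e1, e3]
    field_simp
    ring
  · unfold ferrersQ
    -- At μ = 1/2 the cosine vanishes, so only the term with order -1/2 survives; its quotient of
    -- Gamma values is Γ(s + 1)/Γ(s) = s.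
    rw [show (1 / 2 : ℂ) * Real.pi = Real.pi / 2 by ring, Complex.cos_pi_div_two,
      Complex.sin_pi_div_two, show s - 1 / 2 + 1 / 2 + 1 = s + 1 by ring,
      show s - 1 / 2 - 1 / 2 + 1 = s by ring, Complex.Gamma_add_one s hs0]
    unfold ferrersP
    rw [show -(s - 1 / 2) = 1 / 2 - s by ring, show s - 1 / 2 + 1 = 1 / 2 + s by ring,
      show (1 : ℂ) - -(1 / 2) = 3 / 2 by norm_num,
      hypergeometricF_half_sub_half_add_three_half hs0 hw,
      show (-(1 / 2) / 2 : ℂ) = -(1 / 2 / 2) by norm_num, Complex.cpow_neg, hc]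
    beta_reduce
    generalize ((1 + z) / (1 - z)) ^ (1 / 2 / 2 : ℂ) = t at *
    generalize (1 - (1 - z) / 2) ^ (1 / 2 : ℂ) = q at *
    field_simp
    ring

/-- `(z + √(z² - 1))^{-s}`, up to the factor `2^s`, on the plane cut along `(-∞, 1]`. -/
noncomputable def legendreExp (s z : ℂ) : ℂ :=
  z ^ (-s) * ((1 + (1 - 1 / z ^ 2) ^ (1 / 2 : ℂ)) / 2) ^ (-s)

/-- The branch of `√(z² - 1)` on the plane cut along `(-∞, 1]`. -/
noncomputable def legendreSqrt (z : ℂ) : ℂ := z * (1 - 1 / z ^ 2) ^ (1 / 2 : ℂ)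

theorem legendreSqrt_sq {z : ℂ} (hz : z ∈ legendreDomain) : legendreSqrt z ^ 2 = z ^ 2 - 1 := by
  have h0 := Complex.slitPlane_ne_zero (legendreDomain_mem_slitPlane hz)
  rw [legendreSqrt, mul_pow, Complex.cpow_half_sq]
  field_simp

theorem legendreSqrt_ne_zero {z : ℂ} (hz : z ∈ legendreDomain) : legendreSqrt z ≠ 0 :=
  mul_ne_zero (Complex.slitPlane_ne_zero (legendreDomain_mem_slitPlane hz))
    (Complex.cpow_half_ne_zero (legendreDomain_inv_sq_mem hz))

theorem hasDerivAt_sqrt_one_sub_inv_sq {z : ℂ} (hz : z ∈ legendreDomain) :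
    HasDerivAt (fun z : ℂ => (1 - 1 / z ^ 2) ^ (1 / 2 : ℂ))
      (1 / (z ^ 3 * (1 - 1 / z ^ 2) ^ (1 / 2 : ℂ))) z := by
  have h0 := Complex.slitPlane_ne_zero (legendreDomain_mem_slitPlane hz)
  have hw := legendreDomain_inv_sq_mem hz
  have hq := Complex.cpow_half_ne_zero hw
  refine ((((hasDerivAt_const z (1 : ℂ)).fun_div (hasDerivAt_pow 2 z)
    (pow_ne_zero 2 h0)).const_sub 1).cpow_half hw).congr_deriv ?_
  generalize (1 - 1 / z ^ 2) ^ (1 / 2 : ℂ) = q at *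
  push_cast
  field_simp
  ring

theorem hasDerivAt_legendreSqrt {z : ℂ} (hz : z ∈ legendreDomain) :
    HasDerivAt legendreSqrt (z / legendreSqrt z) z := by
  have h0 := Complex.slitPlane_ne_zero (legendreDomain_mem_slitPlane hz)
  have hq := Complex.cpow_half_ne_zero (legendreDomain_inv_sq_mem hz)
  have hqq := Complex.cpow_half_sq (1 - 1 / z ^ 2)
  refine ((hasDerivAt_id' z).fun_mul (hasDerivAt_sqrt_one_sub_inv_sq hz)).congr_deriv ?_
  unfold legendreSqrt
  generalize (1 - 1 / z ^ 2) ^ (1 / 2 : ℂ) = q at *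
  field_simp at hqq ⊢
  linear_combination hqq

theorem legendreExp_base_mem {z : ℂ} (hz : z ∈ legendreDomain) :
    (1 + (1 - 1 / z ^ 2) ^ (1 / 2 : ℂ)) / 2 ∈ Complex.slitPlane := by
  refine half_mem_slitPlane (Or.inl ?_)
  have := Complex.re_cpow_half_pos (legendreDomain_inv_sq_mem hz)
  rw [Complex.add_re, Complex.one_re]
  positivity

theorem legendreExp_ne_zero (s : ℂ) {z : ℂ} (hz : z ∈ legendreDomain) : legendreExp s z ≠ 0 := by
  have h0 := Complex.slitPlane_ne_zero (legendreDomain_mem_slitPlane hz)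
  have h1 := Complex.slitPlane_ne_zero (legendreExp_base_mem hz)
  refine mul_ne_zero ?_ ?_ <;> rw [Ne, Complex.cpow_eq_zero_iff]
  · exact fun h => h0 h.1
  · exact fun h => h1 h.1

theorem hasDerivAt_legendreExp (s : ℂ) {z : ℂ} (hz : z ∈ legendreDomain) :
    HasDerivAt (legendreExp s) (-s * legendreExp s z / legendreSqrt z) z := by
  have hzs := legendreDomain_mem_slitPlane hz
  have h0 := Complex.slitPlane_ne_zero hzs
  have hm := legendreExp_base_mem hz
  have hm0 := Complex.slitPlane_ne_zero hm
  have hq := Complex.cpow_half_ne_zero (legendreDomain_inv_sq_mem hz)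
  have hqq := Complex.cpow_half_sq (1 - 1 / z ^ 2)
  refine (((hasDerivAt_id' z).cpow_const (c := -s) hzs).fun_mul
    ((((hasDerivAt_sqrt_one_sub_inv_sq hz).const_add 1).div_const 2).cpow_const
      (c := -s) hm)).congr_deriv ?_
  unfold legendreExp legendreSqrt
  rw [Complex.cpow_sub _ _ h0, Complex.cpow_one, Complex.cpow_sub _ _ hm0, Complex.cpow_one]
  generalize ((1 + (1 - 1 / z ^ 2) ^ (1 / 2 : ℂ)) / 2) ^ (-s) = t
  generalize z ^ (-s) = u
  generalize (1 - 1 / z ^ 2) ^ (1 / 2 : ℂ) = q at *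
  have h1 : 1 + q ≠ 0 := fun h => hm0 (by rw [h]; simp)
  field_simp at hqq ⊢
  linear_combination -s * u * t * hqq

/-- The closed form `hypergeometricF_quadratic` at 1/z² supplies the second factor of `legendreExp`.
Of the power z^{-(s+1)}, the part z^{-s} completes it, and the remaining 1/z joins the amplitude. -/
theorem exists_assocLegendreQ_eq {s : ℂ} (hs : 0 < s.re) : ∃ κ : ℂ, κ ≠ 0 ∧ ∃ k : ℂ → ℂ,
    ∀ z ∈ legendreDomain, ContinuousAt k z ∧ k z ^ 4 * (z ^ 2 - 1) = κ ∧
      assocLegendreQ (s - 1 / 2) (1 / 2) z = k z * legendreExp s z := by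
  have hΓ : Complex.Gamma (s + 1) ≠ 0 :=
    Complex.Gamma_ne_zero_of_re_pos (by rw [Complex.add_re, Complex.one_re]; positivity)
  have hπ : (Real.sqrt Real.pi : ℂ) ≠ 0 := by
    exact_mod_cast (Real.sqrt_pos.2 Real.pi_pos).ne'
  have h2s : (2 : ℂ) ^ (s - 1 / 2 + 1) ≠ 0 := by
    rw [Ne, Complex.cpow_eq_zero_iff]; exact fun h => two_ne_zero h.1
  set c : ℂ := Complex.exp (1 / 2 * Real.pi * Complex.I) *
    ((Real.sqrt Real.pi : ℂ) * Complex.Gamma (s + 1) /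
      ((2 : ℂ) ^ (s - 1 / 2 + 1) * Complex.Gamma (s + 1))) with hc
  have hc0 : c ≠ 0 := mul_ne_zero (Complex.exp_ne_zero _)
    (div_ne_zero (mul_ne_zero hπ hΓ) (mul_ne_zero h2s hΓ))
  refine ⟨c ^ 4, pow_ne_zero 4 hc0,
    fun z => c * ((z - 1) ^ (1 / 2 / 2 : ℂ) * (z + 1) ^ (1 / 2 / 2 : ℂ) / z) /
      (1 - 1 / z ^ 2) ^ (1 / 2 : ℂ), fun z hz => ?_⟩
  have hzs := legendreDomain_mem_slitPlane hz
  have h0 := Complex.slitPlane_ne_zero hzs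
  have h1 := Complex.slitPlane_ne_zero (legendreDomain_add_one_mem hz)
  have h2 : z - 1 ≠ 0 := Complex.slitPlane_ne_zero hz
  have hw := legendreDomain_inv_sq_mem hz
  have hq := Complex.cpow_half_ne_zero hw
  refine ⟨?_, ?_, ?_⟩
  · refine ContinuousAt.div (continuousAt_const.mul (ContinuousAt.div (ContinuousAt.mul
      (ContinuousAt.cpow_of_mem (f := fun z : ℂ => z - 1) (by fun_prop) hz _)
      (ContinuousAt.cpow_of_mem (f := fun z : ℂ => z + 1) (by fun_prop)
        (legendreDomain_add_one_mem hz) _)) continuousAt_id h0))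
      (hasDerivAt_sqrt_one_sub_inv_sq hz).continuousAt hq
  · have e1 := Complex.cpow_half_half_pow_four (z - 1)
    have e1' := Complex.cpow_half_half_pow_four (z + 1)
    have e2 := Complex.cpow_half_sq (1 - 1 / z ^ 2)
    have e3 : ((1 - 1 / z ^ 2) ^ (1 / 2 : ℂ)) ^ 4 = ((z - 1) * (z + 1) / z ^ 2) ^ 2 := by
      rw [show 4 = 2 * 2 by norm_num, pow_mul, e2]; field_simp; ring
    simp only [div_pow, mul_pow, e1, e1', e3]
    field_simp
    ring
  · unfold assocLegendreQ legendreExp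
    rw [show s - 1 / 2 + 1 / 2 + 1 = s + 1 by ring, show s - 1 / 2 + 1 / 2 + 2 = s + 2 by ring,
      show s - 1 / 2 + 3 / 2 = s + 1 by ring, hypergeometricF_quadratic _ hw, ← hc,
      Complex.cpow_neg z s, Complex.cpow_add _ _ h0, Complex.cpow_one]
    · have hzs0 : z ^ s ≠ 0 := by
        rw [Ne, Complex.cpow_eq_zero_iff]; exact fun h => h0 h.1
      field_simp
    · intro k h
      have := congrArg Complex.re h
      simp at this
      have hk : (0 : ℝ) ≤ k := k.cast_nonneg
      linarith

/-! ### Differential equations of the Dickson polynomials -/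

-- Dickson polynomials of every kind obey the same two-step recurrence, so only two initial cases
-- need checking.
open Polynomial in
theorem dickson_two_relations (a : ℂ) (n : ℕ) :
    dickson 1 a (n + 1) = 2 * dickson 2 a (n + 1) - X * dickson 2 a n ∧
    dickson 3 a (n + 1) = X * dickson 2 a n := by
  induction n using Nat.twoStepInduction with
  | zero => constructor <;> norm_num [dickson]; ring
  | one =>
    constructor
    · norm_num [dickson]; ring
    · norm_num [dickson]
  | more n h1 h2 =>
    constructor
    · rw [dickson_add_two 1 a (n + 1), h1.1, h2.1, dickson_add_two 2 a (n + 1),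
        dickson_add_two 2 a n]
      ring
    · rw [dickson_add_two 3 a (n + 1), h1.2, h2.2, dickson_add_two 2 a n]
      ring

-- The analogue of T_n' = n U_{n-1} for Chebyshev polynomials. Differentiating the recurrence leaves
-- one undifferentiated D, which the previous relation converts to the second kind.
open Polynomial in
theorem derivative_dickson_one (a : ℂ) (n : ℕ) :
    derivative (dickson 1 a (n + 1)) = (n + 1 : ℂ[X]) * dickson 2 a n := by
  induction n using Nat.twoStepInduction with
  | zero => norm_num [dickson]
  | one => norm_num [dickson]; ring
  | more n h1 h2 =>
    have h3 := (dickson_two_relations a (n + 1)).1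
    rw [dickson_add_two 1 a (n + 1)]
    simp only [derivative_sub, derivative_mul, derivative_X, derivative_C, h1, h2]
    rw [h3, dickson_add_two 2 a n]
    push_cast
    ring

open Polynomial in
/-- `(X² - 4a) E_n = 2 D_{n+2} - X D_{n+1}`. -/
theorem mul_dickson_two (a : ℂ) (n : ℕ) :
    (X ^ 2 - 4 * C a) * dickson 2 a n = 2 * dickson 1 a (n + 2) - X * dickson 1 a (n + 1) := by
  rw [(dickson_two_relations a (n + 1)).1, (dickson_two_relations a n).1, dickson_add_two]
  ring

-- Differentiate `mul_dickson_two` and replace each derivative of a D by a multiple of the second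
-- kind.
open Polynomial in
theorem dickson_one_ode (a : ℂ) (n : ℕ) :
    (X ^ 2 - 4 * C a) * derivative (derivative (dickson 1 a (n + 1))) +
      X * derivative (dickson 1 a (n + 1)) = (n + 1 : ℂ[X]) ^ 2 * dickson 1 a (n + 1) := by
  have h := congrArg derivative (mul_dickson_two a n)
  have h1 := derivative_dickson_one a n
  have h2 := derivative_dickson_one a (n + 1)
  have h3 := (dickson_two_relations a n).1
  simp only [derivative_mul, derivative_sub, derivative_X_pow, derivative_C, derivative_X,
    derivative_ofNat, h1, h2] at h
  rw [h1]
  simp only [derivative_mul, derivative_add, derivative_natCast, derivative_one]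
  push_cast at h ⊢
  simp only [map_ofNat] at h
  linear_combination (n + 1 : ℂ[X]) * h - (n + 1 : ℂ[X]) * (n + 2 : ℂ[X]) * h3

open Polynomial in
/-- `F_n` satisfies the inhomogeneous equation, as an identity of polynomials. -/
theorem dicksonF_ode (a : ℂ) (n : ℕ) :
    (X ^ 2 - 4 * C a) * derivative (derivative (dicksonF n a)) + 3 * X * derivative (dicksonF n a)
      - (n : ℂ[X]) ^ 2 * dicksonF n a = 2 * (n : ℂ[X]) * dicksonD n a := by
  rcases n with _ | n
  · simp [dicksonF]
  unfold dicksonF dicksonD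
  rw [(dickson_two_relations a n).2]
  have h1 := derivative_dickson_one a n
  have h2 := dickson_one_ode a n
  have h3 := congrArg derivative h2
  have hn : (n + 1 : ℂ[X]) ≠ 0 := by exact_mod_cast n.succ_ne_zero
  -- For N = n + 1 one has N F_N = X D_N'. Applying the operator to X D_N' gives X times the
  -- derivative of the equation of D_N plus twice that equation.
  apply mul_left_cancel₀ hn
  rw [h1] at h2 h3
  simp only [derivative_mul, derivative_add, derivative_natCast, derivative_one, derivative_X,
    derivative_sub, derivative_C, derivative_ofNat, h1, derivative_pow,
    derivative_zero] at h2 h3 ⊢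
  push_cast at h2 h3 ⊢
  simp only [map_ofNat] at h3 ⊢
  linear_combination X * h3 + 2 * h2

open Polynomial in
theorem natDegree_dickson_le {k : ℕ} (a : ℂ) (n : ℕ) : (dickson k a n).natDegree ≤ n := by
  induction n using Nat.twoStepInduction with
  | zero =>
    have : (dickson k a 0) = C (3 - k : ℂ) := by simp [map_ofNat]
    rw [this, natDegree_C]
  | one => simp
  | more n h1 h2 =>
    rw [dickson_add_two]
    refine (natDegree_sub_le _ _).trans (max_le ?_ ?_)
    · refine natDegree_mul_le.trans ?_
      simp; omega
    · refine (natDegree_C_mul_le _ _).trans (by omega)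

open Polynomial in
/-- Dickson polynomials have the parity of their index. -/
theorem coeff_dickson_eq_zero {k : ℕ} (a : ℂ) (n : ℕ) :
    ∀ j, ¬ Even (n + j) → (dickson k a n).coeff j = 0 := by
  induction n using Nat.twoStepInduction with
  | zero =>
    intro j hj
    have : (dickson k a 0) = C (3 - k : ℂ) := by simp [map_ofNat]
    rw [this, coeff_C, if_neg]
    rintro rfl
    simp at hj
  | one =>
    intro j hj
    rw [dickson_one, coeff_X, if_neg]
    rintro rfl
    exact hj (by decide)
  | more n h1 h2 =>
    intro j hj
    rw [dickson_add_two, coeff_sub, coeff_C_mul, h1 j (by revert hj; simp only [Nat.even_add]; grind)]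
    rcases j with _ | j
    · simp
    · rw [coeff_X_mul, h2 j (by revert hj; grind)]
      simp

/-! ### Coefficient recurrences and the particular solution -/

open Polynomial in
/-- The polynomial `∑_{k ≤ n} b_k X^k`. -/
noncomputable def particularPolynomial (n : ℕ) (b : ℕ → ℂ) : ℂ[X] :=
  ∑ k ∈ Finset.range (n + 1), C (b k) * X ^ k

open Polynomial in
theorem coeff_particularPolynomial (n : ℕ) (b : ℕ → ℂ) (k : ℕ) :
    (particularPolynomial n b).coeff k = if k ≤ n then b k else 0 := by
  simp [particularPolynomial, coeff_C_mul, coeff_X_pow]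

theorem particularSolution_eq_eval (n : ℕ) (b : ℕ → ℂ) :
    particularSolution n b = fun x => (particularPolynomial n b).eval x := by
  funext x
  simp [particularSolution, particularPolynomial, Polynomial.eval_finsetSum]

open Polynomial in
theorem dicksonOperator_eval (n : ℕ) (a : ℂ) (p : ℂ[X]) (x : ℂ) :
    dicksonOperator n a (fun y => p.eval y) x =
      ((X ^ 2 - 4 * C a) * derivative (derivative p) + 3 * X * derivative p
        - (n : ℂ[X]) ^ 2 * p).eval x := by
  have h : deriv (fun y => p.eval y) = fun y => (derivative p).eval y := by
    funext y; exact p.deriv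
  simp [dicksonOperator, h, Polynomial.deriv]

open Polynomial in
theorem isInhomogeneousSolution_eval_iff (n : ℕ) (a : ℂ) (p : ℂ[X]) :
    IsInhomogeneousSolution n a Set.univ (fun y => p.eval y) ↔
      (X ^ 2 - 4 * C a) * derivative (derivative p) + 3 * X * derivative p
        - (n : ℂ[X]) ^ 2 * p = 2 * (n : ℂ[X]) * dicksonD n a := by
  constructor
  · rintro ⟨-, h⟩
    refine Polynomial.funext fun x => ?_
    rw [← dicksonOperator_eval, h x trivial]
    simp
  · intro h
    refine ⟨p.differentiable.differentiableOn, fun x _ => ?_⟩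
    rw [dicksonOperator_eval, h]
    simp

-- The factor k(k + 2) is k(k - 1) + 3k, from X²F'' and 3XF'; the index shift comes from -4aF''.
open Polynomial in
theorem coeff_dicksonOperator (n : ℕ) (a : ℂ) (p : ℂ[X]) (k : ℕ) :
    ((X ^ 2 - 4 * C a) * derivative (derivative p) + 3 * X * derivative p
        - (n : ℂ[X]) ^ 2 * p).coeff k =
      ((k : ℂ) * (k + 2) - (n : ℂ) ^ 2) * p.coeff k
        - 4 * a * (k + 2) * (k + 1) * p.coeff (k + 2) := by
  have e : (X ^ 2 - 4 * C a) * derivative (derivative p) + 3 * X * derivative p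
        - (n : ℂ[X]) ^ 2 * p = X * (X * derivative (derivative p))
          - C (4 * a) * derivative (derivative p) + C 3 * (X * derivative p)
          - C ((n : ℂ) ^ 2) * p := by
    simp only [map_mul, map_pow, map_natCast, map_ofNat]; ring
  rw [e]
  simp only [coeff_sub, coeff_add, coeff_C_mul]
  rcases k with _ | _ | k
  · simp [coeff_derivative]; ring
  · simp [coeff_derivative]; ring
  · simp only [coeff_X_mul, coeff_derivative]; push_cast; ring

-- Comparison of coefficients. In degrees of parity opposite to n the right side vanishes, which
-- gives the two cases; in degrees above n both sides vanish.
open Polynomial in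
theorem ode_particularPolynomial_iff (n : ℕ) (a : ℂ) (ha : a ≠ 0) (b : ℕ → ℂ)
    (h1 : b (n + 1) = 0) (h2 : b (n + 2) = 0) :
    (X ^ 2 - 4 * C a) * derivative (derivative (particularPolynomial n b)) +
        3 * X * derivative (particularPolynomial n b)
        - (n : ℂ[X]) ^ 2 * particularPolynomial n b = 2 * (n : ℂ[X]) * dicksonD n a ↔
      DicksonRecurrence n a b := by
  -- The range must reach n + 2 because the recurrences at k = n - 1 and k = n involve b (n + 1) and
  -- b (n + 2).
  have hb : ∀ k ≤ n + 2, (particularPolynomial n b).coeff k = b k := by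
    intro k hk
    rw [coeff_particularPolynomial]
    split_ifs with h
    · rfl
    · obtain rfl | rfl : k = n + 1 ∨ k = n + 2 := by omega
      · exact h1.symm
      · exact h2.symm
  have hD : ∀ k, (2 * (n : ℂ[X]) * dicksonD n a).coeff k = 2 * n * (dicksonD n a).coeff k := by
    intro k
    rw [show (2 * (n : ℂ[X])) = C (2 * (n : ℂ)) by simp [map_ofNat], coeff_C_mul]
  have hne : ∀ k : ℕ, (k : ℂ) + 2 ≠ 0 ∧ (k : ℂ) + 1 ≠ 0 := fun k =>
    ⟨by exact_mod_cast (k + 1).succ_ne_zero, by exact_mod_cast k.succ_ne_zero⟩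
  rw [Polynomial.ext_iff]
  simp only [coeff_dicksonOperator, hD]
  constructor
  · intro h k hk
    have hk' := h k
    rw [hb k (by omega), hb (k + 2) (by omega)] at hk'
    obtain ⟨n2, n1⟩ := hne k
    constructor
    · intro hpar
      have : (dicksonD n a).coeff k = 0 := coeff_dickson_eq_zero a n k (by
        rcases hpar with ⟨p, q⟩ | ⟨p, q⟩ <;> grind)
      rw [this] at hk'
      field_simp
      linear_combination -hk'
    · intro hpar
      -- The natural-number division is exact here because n and k have equal parity.
      have : n - 2 * ((n - k) / 2) = k := by
        have h2 : (n - k) % 2 = 0 := by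
          rcases hpar with ⟨p, q⟩ | ⟨p, q⟩
          · rw [Nat.odd_iff] at p q; omega
          · rw [Nat.even_iff] at p q; omega
        omega
      rw [this]
      field_simp
      linear_combination -hk'
  · intro h k
    by_cases hk : k ≤ n
    · obtain ⟨n2, n1⟩ := hne k
      rw [hb k (by omega), hb (k + 2) (by omega)]
      by_cases hpar : Odd n ∧ Even k ∨ Even n ∧ Odd k
      · have hk' := (h k hk).1 hpar
        have : (dicksonD n a).coeff k = 0 := coeff_dickson_eq_zero a n k (by
          rcases hpar with ⟨p, q⟩ | ⟨p, q⟩ <;> grind)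
        rw [this, hk']
        field_simp
        ring
      · have hpar' : Odd n ∧ Odd k ∨ Even n ∧ Even k := by grind
        have hk' := (h k hk).2 hpar'
        have : n - 2 * ((n - k) / 2) = k := by
          have h2 : (n - k) % 2 = 0 := by
            rcases hpar' with ⟨p, q⟩ | ⟨p, q⟩
            · rw [Nat.odd_iff] at p q; omega
            · rw [Nat.even_iff] at p q; omega
          omega
        rw [this] at hk'
        rw [hk']
        field_simp
        ring
    · rw [coeff_particularPolynomial, coeff_particularPolynomial, if_neg hk, if_neg (by omega),
        dicksonD,
          coeff_eq_zero_of_natDegree_lt (lt_of_le_of_lt (natDegree_dickson_le a n) (by omega))]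
      simp

theorem particularPolynomial_coeff_dicksonF (n : ℕ) (a : ℂ) :
    particularPolynomial n (dicksonF n a).coeff = dicksonF n a := by
  ext k
  rw [coeff_particularPolynomial]
  split_ifs with h
  · rfl
  · exact (Polynomial.coeff_eq_zero_of_natDegree_lt
      (lt_of_le_of_lt (natDegree_dickson_le a n) (by omega))).symm

theorem coeff_dicksonF_of_lt {n k : ℕ} (a : ℂ) (h : n < k) : (dicksonF n a).coeff k = 0 :=
  Polynomial.coeff_eq_zero_of_natDegree_lt (lt_of_le_of_lt (natDegree_dickson_le a n) h)

/-! ### Fundamental systems made of Legendre functions -/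

theorem sqrt_sq_add_one_re_pos (n : ℕ) : 0 < ((Real.sqrt ((n : ℝ) ^ 2 + 1) : ℝ) : ℂ).re := by
  rw [Complex.ofReal_re]
  positivity

theorem sqrt_sq_add_one_sq (n : ℕ) : (Real.sqrt ((n : ℝ) ^ 2 + 1) : ℂ) ^ 2 = (n : ℂ) ^ 2 + 1 := by
  have h : Real.sqrt ((n : ℝ) ^ 2 + 1) ^ 2 = (n : ℝ) ^ 2 + 1 := Real.sq_sqrt (by positivity)
  exact_mod_cast congrArg (fun t : ℝ => (t : ℂ)) h

theorem hasDerivAt_cosArcsinSqrt_comp (s : ℂ) {z : ℂ} (hz : (1 - z) / 2 ∈ hypergeometricDomain) :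
    HasDerivAt (fun z => cosArcsinSqrt s ((1 - z) / 2))
      (-(deriv (cosArcsinSqrt s) ((1 - z) / 2) / 2)) z :=
  (HasDerivAt.comp (h₂ := cosArcsinSqrt s) (h := fun z => (1 - z) / 2) z
    (hasDerivAt_cosArcsinSqrt s hz)
      (((hasDerivAt_id' z).const_sub 1).div_const 2)).congr_deriv (by ring)

theorem hasDerivAt_deriv_cosArcsinSqrt_comp (s : ℂ) {z : ℂ}
    (hz : (1 - z) / 2 ∈ hypergeometricDomain) :
    HasDerivAt (fun z => deriv (cosArcsinSqrt s) ((1 - z) / 2))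
      (-(deriv (deriv (cosArcsinSqrt s)) ((1 - z) / 2) / 2)) z :=
  (HasDerivAt.comp (h₂ := deriv (cosArcsinSqrt s)) (h := fun z => (1 - z) / 2) z
    (hasDerivAt_deriv_cosArcsinSqrt s hz)
      (((hasDerivAt_id' z).const_sub 1).div_const 2)).congr_deriv (by ring)

theorem hasDerivAt_deriv_deriv_cosArcsinSqrt_comp (s : ℂ) {z : ℂ}
    (hz : (1 - z) / 2 ∈ hypergeometricDomain) :
    HasDerivAt (fun z => deriv (deriv (cosArcsinSqrt s)) ((1 - z) / 2))
      (-(deriv (deriv (deriv (cosArcsinSqrt s))) ((1 - z) / 2) / 2)) z :=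
  (HasDerivAt.comp (h₂ := deriv (deriv (cosArcsinSqrt s))) (h := fun z => (1 - z) / 2) z
    (hasDerivAt_deriv_deriv_cosArcsinSqrt s hz)
      (((hasDerivAt_id' z).const_sub 1).div_const 2)).congr_deriv (by ring)

section
variable {n : ℕ} {a r : ℂ} {V : Set ℂ} {k g : ℂ → ℂ}

theorem continuousOn_amplitude (hg : ContinuousOn g V) (hg4 : ∀ x ∈ V, g x ^ 4 = x ^ 2 - 4 * a)
    (hne : ∀ x ∈ V, x ^ 2 - 4 * a ≠ 0) (hk : ∀ x ∈ V, ContinuousAt k (x / (2 * r))) :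
    ContinuousOn (fun x => k (x / (2 * r)) / g x) V := by
  refine ContinuousOn.div (fun x hx => ContinuousAt.continuousWithinAt ?_) hg fun x hx h => ?_
  · exact ContinuousAt.comp (g := k) (hk x hx) (continuousAt_id.div_const _)
  · have := hg4 x hx
    rw [h, zero_pow (by norm_num)] at this
    exact hne x hx this.symm

/-- Since z² - 1 = (x² - 4a)/(4a), the fourth power of k/g is 4aκ/(x² - 4a)²; the branches of k and
g need not be related. -/
theorem hasDerivAt_amplitude (ha : a ≠ 0) (hr : r ^ 2 = a) (hV : IsOpen V)
    (hg : ContinuousOn g V) (hg4 : ∀ x ∈ V, g x ^ 4 = x ^ 2 - 4 * a)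
    (hne : ∀ x ∈ V, x ^ 2 - 4 * a ≠ 0) (hk : ∀ x ∈ V, ContinuousAt k (x / (2 * r)))
    {κ : ℂ} (hκ : κ ≠ 0) (hk4 : ∀ x ∈ V, k (x / (2 * r)) ^ 4 * ((x / (2 * r)) ^ 2 - 1) = κ)
    {x : ℂ} (hx : x ∈ V) :
    HasDerivAt (fun x => k (x / (2 * r)) / g x)
      (-(x / (x ^ 2 - 4 * a)) * (k (x / (2 * r)) / g x)) x := by
  refine hasDerivAt_of_pow_four_mul_sq_eq (c := 4 * a * κ)
    (mul_ne_zero (mul_ne_zero (by norm_num) ha) hκ) hV hne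
    (continuousOn_amplitude hg hg4 hne hk) (fun x hx => ?_) hx
  have hX := hne x hx
  have hr0 : r ≠ 0 := by rintro rfl; exact ha (by rw [← hr]; simp)
  rw [div_pow, hg4 x hx, ← hk4 x hx]
  subst hr
  generalize k (x / (2 * r)) = K
  rw [div_eq_div_iff hX (pow_ne_zero 2 hX)]
  field_simp
  ring

theorem amplitude_ne_zero (hg4 : ∀ x ∈ V, g x ^ 4 = x ^ 2 - 4 * a)
    (hne : ∀ x ∈ V, x ^ 2 - 4 * a ≠ 0) {x : ℂ} (hx : x ∈ V)
    (hk : k (x / (2 * r)) ≠ 0) : k (x / (2 * r)) / g x ≠ 0 := by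
  refine div_ne_zero hk fun h => hne x hx ?_
  rw [← hg4 x hx, h, zero_pow (by norm_num)]

theorem isHomogeneousSolution_cosArcsinSqrt (ha : a ≠ 0) (hr : r ^ 2 = a) (hV : IsOpen V)
    (hne : ∀ x ∈ V, x ^ 2 - 4 * a ≠ 0) {s : ℂ} (hs : s ^ 2 = (n : ℂ) ^ 2 + 1) {e : ℂ → ℂ}
    (he : ∀ x ∈ V, HasDerivAt e (-(x / (x ^ 2 - 4 * a)) * e x) x)
    (hw : ∀ x ∈ V, (1 - x / (2 * r)) / 2 ∈ hypergeometricDomain) :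
    IsHomogeneousSolution n a V (fun x => e x * cosArcsinSqrt s ((1 - x / (2 * r)) / 2)) := by
  have hr0 : r ≠ 0 := by rintro rfl; exact ha (by rw [← hr]; simp)
  refine isHomogeneousSolution_mul_chebyshev (p := fun z => cosArcsinSqrt s ((1 - z) / 2))
    (p' := fun z => -(deriv (cosArcsinSqrt s) ((1 - z) / 2) / 2))
    (p'' := fun z => -(-(deriv (deriv (cosArcsinSqrt s)) ((1 - z) / 2) / 2) / 2))
    hV hr hr0 hne he (fun x hx => hasDerivAt_cosArcsinSqrt_comp s (hw x hx))
    (fun x hx => ((hasDerivAt_deriv_cosArcsinSqrt_comp s (hw x hx)).div_const 2).fun_neg)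
    (fun x hx => ?_)
  have := cosArcsinSqrt_ode s (hw x hx)
  rw [← hs]
  linear_combination -this

theorem exists_fundamentalSystem_legendre (ha : a ≠ 0) (hr : r ^ 2 = a) (hV : IsOpen V)
    (hg : ContinuousOn g V) (hg4 : ∀ x ∈ V, g x ^ 4 = x ^ 2 - 4 * a)
    (hne : ∀ x ∈ V, x ^ 2 - 4 * a ≠ 0) (hD : ∀ x ∈ V, x / (2 * r) ∈ legendreDomain) :
    ∃ y₁ y₂ : ℂ → ℂ, IsHomogeneousSolution n a V y₁ ∧ IsHomogeneousSolution n a V y₂ ∧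
      (∀ x ∈ V, y₁ x * deriv y₂ x - deriv y₁ x * y₂ x ≠ 0) ∧
      (∀ x ∈ V, 1 / g x * assocLegendreP (legendreDegree n) (1 / 2) (x / (2 * r)) = y₁ x) ∧
      (∀ x ∈ V, 1 / g x * assocLegendreQ (legendreDegree n) (1 / 2) (x / (2 * r)) = y₂ x) := by
  have hr0 : r ≠ 0 := by rintro rfl; exact ha (by rw [← hr]; simp)
  have hs := sqrt_sq_add_one_sq n
  have hsre := sqrt_sq_add_one_re_pos n
  unfold legendreDegree
  generalize (Real.sqrt ((n : ℝ) ^ 2 + 1) : ℂ) = s at *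
  have hs0 : s ≠ 0 := by rintro rfl; simp at hsre
  obtain ⟨κ₁, hκ₁, k₁, h₁⟩ := exists_assocLegendreP_eq s
  obtain ⟨κ₂, hκ₂, k₂, h₂⟩ := exists_assocLegendreQ_eq hsre
  have he₁ := fun x hx => hasDerivAt_amplitude (x := x) ha hr hV hg hg4 hne
    (fun x hx => (h₁ _ (hD x hx)).1) hκ₁ (fun x hx => (h₁ _ (hD x hx)).2.1) hx
  have he₂ := fun x hx => hasDerivAt_amplitude (x := x) ha hr hV hg hg4 hne
    (fun x hx => (h₂ _ (hD x hx)).1) hκ₂ (fun x hx => (h₂ _ (hD x hx)).2.1) hx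
  have hw := fun x hx => legendreDomain_one_sub_half_mem (hD x hx)
  have hp := fun x hx => hasDerivAt_cosArcsinSqrt_comp s (hw x hx)
  have hq : ∀ x ∈ V, HasDerivAt (legendreExp s)
      ((fun z => -s * legendreExp s z / legendreSqrt z) (x / (2 * r))) (x / (2 * r)) :=
    fun x hx => hasDerivAt_legendreExp s (hD x hx)
  refine ⟨_, _, isHomogeneousSolution_cosArcsinSqrt ha hr hV hne hs he₁ hw,
    isHomogeneousSolution_mul_chebyshev (p := legendreExp s)
      (p' := fun z => -s * legendreExp s z / legendreSqrt z)
      (p'' := fun z => s ^ 2 * legendreExp s z / legendreSqrt z ^ 2 +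
        s * legendreExp s z * z / legendreSqrt z ^ 3) hV hr hr0 hne he₂ hq ?_ ?_,
    fun x hx => ?_, fun x hx => ?_, fun x hx => ?_⟩
  · intro x hx
    have hz := hD x hx
    have hm := legendreSqrt_ne_zero hz
    refine (((hasDerivAt_legendreExp s hz).const_mul (-s)).fun_div
      (hasDerivAt_legendreSqrt hz) hm).congr_deriv ?_
    field_simp
    ring
  · intro x hx
    have hz := hD x hx
    have hm := legendreSqrt_ne_zero hz
    have hm2 := legendreSqrt_sq hz
    rw [← hs, ← hm2]
    field_simp
    ring
  · rw [(hasDerivAt_mul_chebyshev (p := fun z => cosArcsinSqrt s ((1 - z) / 2))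
      (p' := fun z => -(deriv (cosArcsinSqrt s) ((1 - z) / 2) / 2)) he₁ hp hx).deriv,
      (hasDerivAt_mul_chebyshev (p' := fun z => -s * legendreExp s z / legendreSqrt z)
        he₂ hq hx).deriv]
    have hz := hD x hx
    have hm := legendreSqrt_ne_zero hz
    have hm2 := legendreSqrt_sq hz
    have hE := legendreExp_ne_zero s hz
    have hfi := cosArcsinSqrt_first_integral s (hw x hx)
    have hk₁ : k₁ (x / (2 * r)) ≠ 0 := fun h => hκ₁ (by rw [← (h₁ _ hz).2.1, h]; simp)
    have hk₂ : k₂ (x / (2 * r)) ≠ 0 := fun h => hκ₂ (by rw [← (h₂ _ hz).2.1, h]; simp)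
    have hA₁ := amplitude_ne_zero hg4 hne hx hk₁
    have hA₂ := amplitude_ne_zero hg4 hne hx hk₂
    generalize k₁ (x / (2 * r)) / g x = e₁ at *
    generalize k₂ (x / (2 * r)) / g x = e₂ at *
    generalize legendreExp s (x / (2 * r)) = E at *
    generalize x / (2 * r) = z at *
    generalize cosArcsinSqrt s ((1 - z) / 2) = c at *
    generalize deriv (cosArcsinSqrt s) ((1 - z) / 2) = c' at *
    generalize legendreSqrt z = m at *
    intro h
    -- Up to sign this is the Wronskian; the terms from the logarithmic derivatives of the
    -- amplitudes cancel.
    have h' : e₁ * e₂ * E / (2 * r * m) * (s * c - c' * m / 2) = 0 := by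
      rw [← neg_eq_zero, ← h]
      field_simp
      ring
    have h'' : s * c - c' * m / 2 = 0 := (mul_eq_zero.1 h').resolve_left
      (div_ne_zero (mul_ne_zero (mul_ne_zero hA₁ hA₂) hE)
        (mul_ne_zero (mul_ne_zero two_ne_zero hr0) hm))
    -- As m² = z² - 1, the vanishing factor divides s²c² - m²c'²/4, which the first integral equates
    -- to s².
    refine hs0 (pow_eq_zero_iff two_ne_zero |>.1 ?_)
    rw [← hfi]
    linear_combination (s * c + c' * m / 2) * h'' + c' ^ 2 / 4 * hm2
  · rw [(h₁ _ (hD x hx)).2.2]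
    ring
  · rw [(h₂ _ (hD x hx)).2.2]
    ring

theorem exists_fundamentalSystem_ferrers (ha : a ≠ 0) (hr : r ^ 2 = a) (hV : IsOpen V)
    (hg : ContinuousOn g V) (hg4 : ∀ x ∈ V, g x ^ 4 = x ^ 2 - 4 * a)
    (hne : ∀ x ∈ V, x ^ 2 - 4 * a ≠ 0) (hD : ∀ x ∈ V, x / (2 * r) ∈ ferrersDomain) :
    ∃ y₁ y₂ : ℂ → ℂ, IsHomogeneousSolution n a V y₁ ∧ IsHomogeneousSolution n a V y₂ ∧
      (∀ x ∈ V, y₁ x * deriv y₂ x - deriv y₁ x * y₂ x ≠ 0) ∧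
      (∀ x ∈ V, 1 / g x * ferrersP (legendreDegree n) (1 / 2) (x / (2 * r)) = y₁ x) ∧
      (∀ x ∈ V, 1 / g x * ferrersQ (legendreDegree n) (1 / 2) (x / (2 * r)) = y₂ x) := by
  have hr0 : r ≠ 0 := by rintro rfl; exact ha (by rw [← hr]; simp)
  have hs := sqrt_sq_add_one_sq n
  have hsre := sqrt_sq_add_one_re_pos n
  unfold legendreDegree
  generalize (Real.sqrt ((n : ℝ) ^ 2 + 1) : ℂ) = s at *
  have hs0 : s ≠ 0 := by rintro rfl; simp at hsre
  obtain ⟨κ₁, hκ₁, k₁, h₁⟩ := exists_ferrersP_eq s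
  obtain ⟨κ₂, hκ₂, k₂, h₂⟩ := exists_ferrersQ_eq hsre
  have he₁ := fun x hx => hasDerivAt_amplitude (x := x) ha hr hV hg hg4 hne
    (fun x hx => (h₁ _ (hD x hx)).1) hκ₁ (fun x hx => (h₁ _ (hD x hx)).2.1) hx
  have hz2 : ∀ x ∈ V, (x / (2 * r)) ^ 2 - 1 = (x ^ 2 - 4 * a) / (4 * a) := by
    intro x _
    subst hr
    field_simp
    ring
  have hk₂ : ∀ x ∈ V, k₂ (x / (2 * r)) ≠ 0 := by
    intro x hx h
    have h4 := (h₂ _ (hD x hx)).2.1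
    rw [h, zero_pow (by norm_num), hz2 x hx, eq_comm] at h4
    exact mul_ne_zero hκ₂ (div_ne_zero (hne x hx) (mul_ne_zero (by norm_num) ha)) h4
  have hA₂ := fun x hx => amplitude_ne_zero (x := x) hg4 hne hx (hk₂ x hx)
  -- Here k₂ behaves like (z² - 1)^{1/4} rather than its inverse, so k₂/g has constant fourth power
  -- and is locally constant.
  have he₂ : ∀ x ∈ V, HasDerivAt (fun x => k₂ (x / (2 * r)) / g x) 0 x := by
    intro x hx
    have hc := continuousOn_amplitude hg hg4 hne (fun x hx => (h₂ _ (hD x hx)).1)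
    refine ((hasDerivAt_const x (κ₂ / (4 * a))).of_pow_four_eq
      (hc.continuousAt (hV.mem_nhds hx)) ?_ (hA₂ x hx)).congr_deriv (zero_div _)
    filter_upwards [hV.mem_nhds hx] with y hy
    have hX := hne y hy
    rw [div_pow, hg4 y hy, (h₂ _ (hD y hy)).2.1, hz2 y hy]
    field_simp
  have hw := fun x hx => ferrersDomain_one_sub_half_mem (hD x hx)
  have hp := fun x hx => hasDerivAt_cosArcsinSqrt_comp s (hw x hx)
  have hq : ∀ x ∈ V, HasDerivAt
      (fun x => k₂ (x / (2 * r)) / g x * deriv (cosArcsinSqrt s) ((1 - x / (2 * r)) / 2))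
      (k₂ (x / (2 * r)) / g x *
        (-(deriv (deriv (cosArcsinSqrt s)) ((1 - x / (2 * r)) / 2) / 2) / (2 * r))) x := by
    intro x hx
    refine ((he₂ x hx).fun_mul
      (hasDerivAt_comp_div_two_mul (p := fun z => deriv (cosArcsinSqrt s) ((1 - z) / 2))
      (hasDerivAt_deriv_cosArcsinSqrt_comp s (hw x hx)))).congr_deriv ?_
    ring
  refine ⟨_, _, isHomogeneousSolution_cosArcsinSqrt ha hr hV hne hs he₁ hw,
    IsHomogeneousSolution.of_hasDerivAt hV hq
      (y'' := fun x => k₂ (x / (2 * r)) / g x *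
        (deriv (deriv (deriv (cosArcsinSqrt s))) ((1 - x / (2 * r)) / 2) / (16 * r ^ 2))) ?_ ?_,
    fun x hx => ?_, fun x hx => ?_, fun x hx => ?_⟩
  · intro x hx
    refine ((he₂ x hx).fun_mul (((hasDerivAt_comp_div_two_mul
      (p := fun z => deriv (deriv (cosArcsinSqrt s)) ((1 - z) / 2))
      (hasDerivAt_deriv_deriv_cosArcsinSqrt_comp s (hw x hx))).div_const 2).fun_neg.div_const
        (2 * r))).congr_deriv ?_
    field_simp
    ring
  · intro x hx
    -- With s² - 1 = n² and w = (1 - z)/2 this is already the homogeneous equation, so no passage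
    -- through Chebyshev's equation is needed for the second solution.
    have h := deriv_cosArcsinSqrt_ode s (hw x hx)
    have hz := hz2 x hx
    obtain ⟨z, rfl⟩ : ∃ z, x = 2 * r * z := ⟨x / (2 * r), by field_simp⟩
    rw [show 2 * r * z / (2 * r) = z by field_simp] at *
    subst hr
    rw [hs] at h
    generalize k₂ z / g (2 * r * z) = E at *
    field_simp
    linear_combination -32 * E * h
  · rw [(hasDerivAt_mul_chebyshev (p := fun z => cosArcsinSqrt s ((1 - z) / 2))
      (p' := fun z => -(deriv (cosArcsinSqrt s) ((1 - z) / 2) / 2)) he₁ hp hx).deriv,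
      (hq x hx).deriv]
    have hfi := cosArcsinSqrt_first_integral s (hw x hx)
    have hode := cosArcsinSqrt_ode s (hw x hx)
    have hk₁ : k₁ (x / (2 * r)) ≠ 0 := fun h => hκ₁ (by rw [← (h₁ _ (hD x hx)).2.1, h]; simp)
    have hA₁ := amplitude_ne_zero hg4 hne hx hk₁
    have hA₂ := hA₂ x hx
    have hX := hne x hx
    have hz := hz2 x hx
    generalize k₁ (x / (2 * r)) / g x = e₁ at *
    generalize k₂ (x / (2 * r)) / g x = e₂ at *
    obtain ⟨z, rfl⟩ : ∃ z, x = 2 * r * z := ⟨x / (2 * r), by field_simp⟩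
    rw [show 2 * r * z / (2 * r) = z by field_simp] at *
    subst hr
    generalize cosArcsinSqrt s ((1 - z) / 2) = c at *
    generalize deriv (deriv (cosArcsinSqrt s)) ((1 - z) / 2) = c'' at *
    generalize deriv (cosArcsinSqrt s) ((1 - z) / 2) = c' at *
    have hz1 : z ^ 2 - 1 ≠ 0 := fun h0 => hX (by linear_combination 4 * r ^ 2 * h0)
    rw [show (2 * r * z) ^ 2 - 4 * r ^ 2 = 4 * r ^ 2 * (z ^ 2 - 1) by ring]
    -- Eliminating c'' by the second-order equation turns the Wronskian into a multiple of the first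
    -- integral, whence the factor s².
    have : e₁ * c * (e₂ * (-(c'' / 2) / (2 * r))) - e₁ * (-(c' / 2) / (2 * r) -
        2 * r * z / (4 * r ^ 2 * (z ^ 2 - 1)) * c) * (e₂ * c') =
        -(e₁ * e₂ * s ^ 2) / (r * (z ^ 2 - 1)) := by
      rw [← hfi]
      field_simp
      linear_combination 16 * c * hode
    rw [this]
    exact div_ne_zero (neg_ne_zero.2 (mul_ne_zero (mul_ne_zero hA₁ hA₂) (pow_ne_zero 2 hs0)))
      (mul_ne_zero hr0 hz1)
  · rw [(h₁ _ (hD x hx)).2.2]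
    ring
  · rw [(h₂ _ (hD x hx)).2.2]
    ring
end

/-! ### Assembly of the theorem -/

theorem sq_sub_ne_zero_of_div_sq_ne_one {a r x : ℂ} (ha : a ≠ 0) (hr : r ^ 2 = a)
    (h : (x / (2 * r)) ^ 2 ≠ 1) : x ^ 2 - 4 * a ≠ 0 := by
  intro h0
  apply h
  subst hr
  have hr0 : r ≠ 0 := fun h => ha (by rw [h]; simp)
  field_simp
  linear_combination h0

theorem legendreDomain_sq_ne_one {z : ℂ} (hz : z ∈ legendreDomain) : z ^ 2 ≠ 1 := by
  have h1 := Complex.slitPlane_ne_zero (legendreDomain_add_one_mem hz)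
  have h2 : z - 1 ≠ 0 := Complex.slitPlane_ne_zero hz
  exact fun h => mul_ne_zero h1 h2 (by linear_combination h)

theorem ferrersDomain_sq_ne_one {z : ℂ} (hz : z ∈ ferrersDomain) : z ^ 2 ≠ 1 := by
  have h1 := Complex.slitPlane_ne_zero hz.1
  have h2 := Complex.slitPlane_ne_zero hz.2
  exact fun h => mul_ne_zero h1 h2 (by linear_combination -h)

theorem IsInhomogeneousSolution.mono {n : ℕ} {a : ℂ} {U V : Set ℂ} {F : ℂ → ℂ}
    (h : IsInhomogeneousSolution n a V F) (hUV : U ⊆ V) : IsInhomogeneousSolution n a U F :=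
  ⟨h.1.mono hUV, fun x hx => h.2 x (hUV hx)⟩

theorem theorem1p2 (n : ℕ) (a : ℂ) (ha : a ≠ 0) :
    -- the particular solution
    (∃ b : ℕ → ℂ, b (n + 1) = 0 ∧ b (n + 2) = 0 ∧ DicksonRecurrence n a b) ∧
    (∀ b : ℕ → ℂ, b (n + 1) = 0 → b (n + 2) = 0 →
      (IsInhomogeneousSolution n a Set.univ (particularSolution n b) ↔
        DicksonRecurrence n a b)) ∧
    -- the general solutions, for either pair of associated Legendre functions,
    -- any square root of `a` and any branch of the fourth root of `x² - 4a`
    (∀ r : ℂ, r ^ 2 = a →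
      ∀ V : Set ℂ, IsOpen V → IsPreconnected V →
      ∀ g : ℂ → ℂ, ContinuousOn g V → (∀ x ∈ V, g x ^ 4 = x ^ 2 - 4 * a) →
      ∀ P Q : ℂ → ℂ,
        ((P = assocLegendreP (legendreDegree n) (1 / 2) ∧
            Q = assocLegendreQ (legendreDegree n) (1 / 2) ∧
            ∀ x ∈ V, x / (2 * r) ∈ legendreDomain) ∨
          (P = ferrersP (legendreDegree n) (1 / 2) ∧
            Q = ferrersQ (legendreDegree n) (1 / 2) ∧
            ∀ x ∈ V, x / (2 * r) ∈ ferrersDomain)) →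
        (∀ F : ℂ → ℂ, IsHomogeneousSolution n a V F ↔
          ∃ A B : ℂ, ∀ x ∈ V, F x = complementarySolution P Q g r A B x) ∧
        (∀ b : ℕ → ℂ, b (n + 1) = 0 → b (n + 2) = 0 → DicksonRecurrence n a b →
          (∀ F : ℂ → ℂ, IsInhomogeneousSolution n a V F ↔
            ∃ A B : ℂ, ∀ x ∈ V,
              F x = complementarySolution P Q g r A B x + particularSolution n b x) ∧
          ∃ A B : ℂ, ∀ x ∈ V, (dicksonF n a).eval x =
            complementarySolution P Q g r A B x + particularSolution n b x)) := by
  have hiff : ∀ b : ℕ → ℂ, b (n + 1) = 0 → b (n + 2) = 0 →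
      (IsInhomogeneousSolution n a Set.univ (particularSolution n b) ↔
        DicksonRecurrence n a b) := by
    intro b h1 h2
    rw [particularSolution_eq_eval, isInhomogeneousSolution_eval_iff,
      ode_particularPolynomial_iff n a ha b h1 h2]
  have hF : IsInhomogeneousSolution n a Set.univ (fun x => (dicksonF n a).eval x) :=
    (isInhomogeneousSolution_eval_iff n a _).2 (dicksonF_ode a n)
  -- The coefficients of F_n are a solution of the recurrences, since F_n solves the inhomogeneous
  -- equation and has degree at most n.
  refine ⟨⟨(dicksonF n a).coeff, coeff_dicksonF_of_lt a (by omega),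
      coeff_dicksonF_of_lt a (by omega),
    ?_⟩, hiff, ?_⟩
  · rw [← hiff _ (coeff_dicksonF_of_lt a (by omega)) (coeff_dicksonF_of_lt a (by omega)),
      particularSolution_eq_eval, particularPolynomial_coeff_dicksonF]
    exact hF
  intro r hr V hV hVc g hg hg4 P Q hPQ
  -- The singular points x = ±2r correspond to z = ±1, which lie on the cuts in both cases.
  have hne : ∀ x ∈ V, x ^ 2 - 4 * a ≠ 0 := by
    rcases hPQ with ⟨-, -, hD⟩ | ⟨-, -, hD⟩
    · exact fun x hx => sq_sub_ne_zero_of_div_sq_ne_one ha hr (legendreDomain_sq_ne_one (hD x hx))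
    · exact fun x hx => sq_sub_ne_zero_of_div_sq_ne_one ha hr (ferrersDomain_sq_ne_one (hD x hx))
  obtain ⟨y₁, y₂, hy₁, hy₂, hW, e₁, e₂⟩ : ∃ y₁ y₂ : ℂ → ℂ, IsHomogeneousSolution n a V y₁ ∧
      IsHomogeneousSolution n a V y₂ ∧ (∀ x ∈ V, y₁ x * deriv y₂ x - deriv y₁ x * y₂ x ≠ 0) ∧
      (∀ x ∈ V, 1 / g x * P (x / (2 * r)) = y₁ x) ∧
      (∀ x ∈ V, 1 / g x * Q (x / (2 * r)) = y₂ x) := by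
    rcases hPQ with ⟨rfl, rfl, hD⟩ | ⟨rfl, rfl, hD⟩
    · exact exists_fundamentalSystem_legendre ha hr hV hg hg4 hne hD
    · exact exists_fundamentalSystem_ferrers ha hr hV hg hg4 hne hD
  have hcomp : ∀ A B : ℂ, ∀ x ∈ V, complementarySolution P Q g r A B x = A * y₁ x + B * y₂ x := by
    intro A B x hx
    rw [← e₁ x hx, ← e₂ x hx]
    unfold complementarySolution
    ring
  have hhom : ∀ F : ℂ → ℂ, IsHomogeneousSolution n a V F ↔
      ∃ A B : ℂ, ∀ x ∈ V, F x = complementarySolution P Q g r A B x := by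
    intro F
    rw [isHomogeneousSolution_iff_of_wronskian_ne_zero hV hVc hne hy₁ hy₂ hW F]
    exact exists_congr fun A => exists_congr fun B => forall₂_congr fun x hx => by
      rw [hcomp A B x hx]
  refine ⟨hhom, fun b h1 h2 hb => ?_⟩
  have hp := ((hiff b h1 h2).2 hb).mono (Set.subset_univ V)
  have hinhom : ∀ F : ℂ → ℂ, IsInhomogeneousSolution n a V F ↔ ∃ A B : ℂ, ∀ x ∈ V,
      F x = complementarySolution P Q g r A B x + particularSolution n b x := by
    intro F
    rw [isInhomogeneousSolution_iff_sub hV hp, hhom]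
    simp only [sub_eq_iff_eq_add]
  exact ⟨hinhom, (hinhom _).1 (hF.mono (Set.subset_univ V))⟩
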